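/- Let $\Omega\subset\mathbb{R}^d$ be a bounded open set with $C^\infty$ boundary, outward unit normal $\nu$ and surface measure $\sigma$ on $\partial\Omega$. Let $X\in\mathbb{R}^d\setminus\{0\}$ be a constant vector, $D_j=\frac1i\partial_j$, and for $z\in\mathbb{C}$, $h>0$ let $$P_z=(hD)^2+i\langle X,hD\rangle-z .$$ Put $\partial\Omega_-=\{x\in\partial\Omega:\langle X,\nu\rangle<0\}$ and $\Gamma_+=\{x\in\partial\Omega:\langle X,\nu\rangle\ge 0\}$, and for $S\subset\partial\Omega$ write $(f,g)_S=\int_S f\bar g\,d\sigma$. $C^\infty(\overline\Omega)$ denotes the restrictions to $\overline\Omega$ of smooth functions on $\mathbb{R}^d$. Let $\psi\in C^\infty(\overline\Omega)$ be real-valued, and suppose that either 1. $\psi$ is locally strictly convex, i.e. $\partial^2\psi$ is positive definite at every point of $\overline\Omega$; in this case let $\|v\|_W^2=\|v\|_{H_h^1}^2=\|v\|_{L^2(\Omega)}^2+\|hDv\|_{L^2(\Omega)}^2$; or 2. $\psi(x)=\psi_1(\langle x,X\rangle)$ on $\overline\Omega$, where $\psi_1\in C^\infty(\mathbb{R};\mathbb{R})$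 and $\psi_1''>0$ on $\{\langle x,X\rangle:x\in\overline\Omega\}$; in this case let $\|v\|_W=\|v\|_{H_X}=\|v\|_{L^2(\Omega)}+\|\langle X,hD\rangle v\|_{L^2(\Omega)}$. Then there are constants $C,\delta,h_0>0$, depending only on $\Omega$, $X$ and $\psi$, such that for all $z\in\mathbb{C}$, all $0<h<h_0$, all $0<\epsilon\le\delta$ ($\epsilon$ may depend on $h$), and all complex-valued $u\in C^\infty(\overline\Omega)$ with $u|_{\partial\Omega}=0$, $$-h^3\left(\langle 2\epsilon\,\partial\psi+X,\nu\rangle e^{\epsilon\psi/h}\partial_\nu u,\;e^{\epsilon\psi/h}\partial_\nu u\right)_{\partial\Omega_-}+Ch\epsilon\,\|e^{\epsilon\psi/h}u\|_W^2$$ $$\le\;\|e^{\epsilon\psi/h}P_zu\|_{L^2(\Omega)}^2+h^3\left(\langle 2\epsilon\,\partial\psi+X,\nu\rangle e^{\epsilon\psi/h}\partial_\nu u,\;e^{\epsilon\psi/h}\partial_\nu u\right)_{\Gamma_+}.$$ -/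

import Mathlib

open MeasureTheory
open scoped ContDiff InnerProductSpace

noncomputable section

namespace SemiclassicalCarleman

/-- Euclidean space `ℝ^d`. -/
abbrev Euc (d : ℕ) := EuclideanSpace ℝ (Fin d)

variable {d : ℕ}

/-! ### Bounded domains with smooth boundary -/

/-- On the open set `U`, the function `ρ` is smooth with nowhere vanishing gradient, and
`Ω ∩ U = {ρ < 0} ∩ U`. -/
structure IsDefiningFunctionOn (Ω U : Set (Euc d)) (ρ : Euc d → ℝ) : Prop where
  isOpen : IsOpen U
  contDiffOn : ContDiffOn ℝ ∞ ρ U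
  gradient_ne_zero : ∀ x ∈ U, gradient ρ x ≠ 0
  mem_iff : ∀ x ∈ U, x ∈ Ω ↔ ρ x < 0

/-- A bounded open set with `C^∞` boundary (it need not be connected). -/
structure IsBoundedSmoothDomain (Ω : Set (Euc d)) : Prop where
  isOpen : IsOpen Ω
  isBounded : Bornology.IsBounded Ω
  smooth_boundary : ∀ x ∈ frontier Ω, ∃ U : Set (Euc d), ∃ ρ : Euc d → ℝ,
    x ∈ U ∧ IsDefiningFunctionOn Ω U ρ

/-- `n` is the outward unit normal to `∂Ω` at `x`: the normalized gradient of a local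
defining function (it does not depend on the choice of that function). -/
def IsOutwardUnitNormal (Ω : Set (Euc d)) (x n : Euc d) : Prop :=
  ∃ U : Set (Euc d), ∃ ρ : Euc d → ℝ, x ∈ U ∧ IsDefiningFunctionOn Ω U ρ ∧
    n = ‖gradient ρ x‖⁻¹ • gradient ρ x

open Classical in
/-- The outward unit normal `ν(x)`, for `x ∈ ∂Ω` (and `0` at points where there is none). -/
def outwardNormal (Ω : Set (Euc d)) (x : Euc d) : Euc d :=
  if hx : ∃ n, IsOutwardUnitNormal Ω x n then hx.choose else 0

/-- Illuminated side `∂Ω₊`. -/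
def boundaryPlus (Ω : Set (Euc d)) (X : Euc d) : Set (Euc d) :=
  {x ∈ frontier Ω | 0 < ⟪X, outwardNormal Ω x⟫_ℝ}

/-- Glancing set `∂Ω₀`. -/
def boundaryZero (Ω : Set (Euc d)) (X : Euc d) : Set (Euc d) :=
  {x ∈ frontier Ω | ⟪X, outwardNormal Ω x⟫_ℝ = 0}

/-- Shadow side `∂Ω₋`. -/
def boundaryMinus (Ω : Set (Euc d)) (X : Euc d) : Set (Euc d) :=
  {x ∈ frontier Ω | ⟪X, outwardNormal Ω x⟫_ℝ < 0}

/-- `Γ₊ = ∂Ω₊ ∪ ∂Ω₀`. -/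
def gammaPlus (Ω : Set (Euc d)) (X : Euc d) : Set (Euc d) :=
  boundaryPlus Ω X ∪ boundaryZero Ω X

/-! ### Differential operators -/

/-- `D_j u = (1/i) ∂_j u`. -/
def D (j : Fin d) (u : Euc d → ℂ) (x : Euc d) : ℂ :=
  (1 / Complex.I) * fderiv ℝ u x (EuclideanSpace.single j 1)

/-- `(hD)² u = ∑_j (h D_j)(h D_j) u`. -/
def hDsq (h : ℝ) (u : Euc d → ℂ) (x : Euc d) : ℂ :=
  ∑ j, (h : ℂ) ^ 2 * D j (D j u) x

/-- `⟨X, hD⟩ u = ∑_j X_j h D_j u`, for a constant vector field `X`. -/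
def XhD (X : Euc d) (h : ℝ) (u : Euc d → ℂ) (x : Euc d) : ℂ :=
  ∑ j, (X j : ℂ) * ((h : ℂ) * D j u x)

/-- `P_z u = (hD)² u + i ⟨X, hD⟩ u - z u`. -/
def Pz (X : Euc d) (z : ℂ) (h : ℝ) (u : Euc d → ℂ) (x : Euc d) : ℂ :=
  hDsq h u x + Complex.I * XhD X h u x - z * u x

/-- The conjugating factor applied to a function: `e^{εψ/h} u`. -/
def weighted (ψ : Euc d → ℝ) (ε h : ℝ) (u : Euc d → ℂ) (x : Euc d) : ℂ :=
  (Real.exp (ε * ψ x / h) : ℂ) * u x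

/-! ### Norms on `Ω` -/

/-- The norm of `L²(Ω)`. -/
def normL2 (Ω : Set (Euc d)) (v : Euc d → ℂ) : ℝ :=
  lpNorm v 2 (volume.restrict Ω)

/-- The semiclassical Sobolev norm of `H_h^1(Ω)`,
`‖v‖² = ‖v‖²_{L²} + ∑_j ‖h D_j v‖²_{L²}`. -/
def normH1 (Ω : Set (Euc d)) (h : ℝ) (v : Euc d → ℂ) : ℝ :=
  Real.sqrt (normL2 Ω v ^ 2 + ∑ j, normL2 Ω (fun x => (h : ℂ) * D j v x) ^ 2)

/-- `‖v‖_{H_X} = ‖v‖_{L²} + ‖⟨X, hD⟩ v‖_{L²}`. -/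
def normHX (Ω : Set (Euc d)) (X : Euc d) (h : ℝ) (v : Euc d → ℂ) : ℝ :=
  normL2 Ω v + normL2 Ω (XhD X h v)

/-! ### Boundary terms and the estimate -/

/-- The outward normal derivative `∂_ν u` on `∂Ω`. -/
def normalDeriv (Ω : Set (Euc d)) (u : Euc d → ℂ) (x : Euc d) : ℂ :=
  fderiv ℝ u x (outwardNormal Ω x)

/-- `(⟨2ε∂ψ + X, ν⟩ e^{εψ/h} ∂_ν u, e^{εψ/h} ∂_ν u)_S` for `S ⊆ ∂Ω`, with respect to
`(d-1)`-dimensional surface measure (Hausdorff measure with the Euclidean normalization). -/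
def boundaryTerm (Ω : Set (Euc d)) (X : Euc d) (ψ : Euc d → ℝ) (ε h : ℝ)
    (u : Euc d → ℂ) (S : Set (Euc d)) : ℝ :=
  ∫ x in S, ⟪(2 * ε) • gradient ψ x + X, outwardNormal Ω x⟫_ℝ *
    ‖weighted ψ ε h (normalDeriv Ω u) x‖ ^ 2 ∂(μHE[d - 1])

/-- The inequality
`-h³ (⟨2ε∂ψ+X,ν⟩ e^{εψ/h}∂_ν u, e^{εψ/h}∂_ν u)_{∂Ω₋} + C h ε ‖e^{εψ/h}u‖_W²`
`≤ ‖e^{εψ/h} P_z u‖²_{L²} + h³ (⟨2ε∂ψ+X,ν⟩ e^{εψ/h}∂_ν u, e^{εψ/h}∂_ν u)_{Γ₊}`,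
where `W` is the norm (depending on `h`) on the left. -/
def CarlemanInequality (Ω : Set (Euc d)) (X : Euc d) (z : ℂ) (ψ : Euc d → ℝ)
    (W : ℝ → (Euc d → ℂ) → ℝ) (C h ε : ℝ) (u : Euc d → ℂ) : Prop :=
  -h ^ 3 * boundaryTerm Ω X ψ ε h u (boundaryMinus Ω X)
      + C * h * ε * W h (weighted ψ ε h u) ^ 2
    ≤ normL2 Ω (weighted ψ ε h (Pz X z h u)) ^ 2
      + h ^ 3 * boundaryTerm Ω X ψ ε h u (gammaPlus Ω X)

/-- The weighted estimate, with constants `C, δ, h₀` which may depend on `Ω`, `X`, `ψ` only: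
it holds for all spectral parameters `z`, all `0 < h < h₀`, all `0 < ε ≤ δ`, and all
`u ∈ C^∞(Ω̄)` (restrictions to `Ω̄` of smooth functions on `ℝ^d`) vanishing on `∂Ω`. -/
def CarlemanEstimate (Ω : Set (Euc d)) (X : Euc d) (ψ : Euc d → ℝ)
    (W : ℝ → (Euc d → ℂ) → ℝ) : Prop :=
  ∃ C > 0, ∃ δ > 0, ∃ h₀ > 0, ∀ (z : ℂ) (h ε : ℝ), 0 < h → h < h₀ → 0 < ε → ε ≤ δ →
    ∀ u : Euc d → ℂ, ContDiff ℝ ∞ u → (∀ x ∈ frontier Ω, u x = 0) →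
      CarlemanInequality Ω X z ψ W C h ε u

/-- `∂²ψ` is positive definite at every point of `Ω̄`. -/
def LocallyStrictlyConvex (Ω : Set (Euc d)) (ψ : Euc d → ℝ) : Prop :=
  ∀ x ∈ closure Ω, ∀ ξ : Euc d, ξ ≠ 0 → 0 < fderiv ℝ (fderiv ℝ ψ) x ξ ξ

/-- On `Ω̄`, `ψ(x) = ψ₁(⟨x, X⟩)` with `ψ₁` smooth and `ψ₁'' > 0` at all the values of
`⟨x, X⟩` on `Ω̄`. -/
def IsConvexInDirection (Ω : Set (Euc d)) (X : Euc d) (ψ : Euc d → ℝ) : Prop :=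
  ∃ ψ₁ : ℝ → ℝ, ContDiff ℝ ∞ ψ₁ ∧
    (∀ x ∈ closure Ω, 0 < deriv (deriv ψ₁) ⟪x, X⟫_ℝ) ∧
    (∀ x ∈ closure Ω, ψ x = ψ₁ ⟪x, X⟫_ℝ)

end SemiclassicalCarleman

end

/-! Conjugation. With `v = e^{εψ/h} u` one has `e^{εψ/h} P_z u = (A + B - i Im z) v`, where `A =
-h²Δ - V` (`symPart`) is symmetric and `B = h(Y·∇ + ½ div Y)` (`skewPart`) is antisymmetric. Here `Y
= 2ε∂ψ + X`, and `V = ε²|∂ψ|² + ε⟨X, ∂ψ⟩ + Re z`. Both operators are real, so `v` can be treated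
through its real and imaginary parts.

Positive commutator. Expanding `‖(A + B - i Im z) v‖²` and dropping squares leaves the cross terms.
The one with `Im z` vanishes by Green's identity (`integral_green`), and `Re z` only shifts `V` by a
constant while only `∇V` enters, so the estimate is uniform in `z`. The cross term of `A` and `B` is
computed by a Rellich identity (`integral_symPart_mul_skewPart`). Since `DY = 2ε ∂²ψ` and `∇V = ε
∂²ψ Y`, it equals the integral of `hε (4h² ∂²ψ(∇v, ∇v) + ∂²ψ(Y, Y)|v|² - h² Δ²ψ |v|²)`, with the
Hessian form summed over the two parts of `v`, minus the boundary term `h³ ∫ ⟨Y, ν⟩ |∂_ν v|²`.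

Positivity. Both convexity conditions give `∂²ψ(ξ, ξ) ≥ c ⟨X, ξ⟩²` on `Ω`. For small `ε`, `⟨X, Y⟩ ≥
|X|²/2`, so `∂²ψ(Y, Y)` is bounded below and absorbs `h² Δ²ψ` for small `h` (`carleman_density`).
The gradient term then controls `hDv` in the strictly convex case and `⟨X, hD⟩v` in the directional
case.

Divergence theorem. The surface measure is Hausdorff measure, and `integral_divergence` is obtained
without an area formula. On a small patch the boundary is almost flat, its projection to the tangent
hyperplane is almost isometric, and Fubini with the fundamental theorem of calculus gives the flux
up to an error `κ ∫ |f|`. Such errors add up over a partition of unity to a multiple of `κ ∫_{∂Ω}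
|f|`, and `κ` is arbitrary. -/

noncomputable section

namespace SemiclassicalCarleman

/-! ### Oblique product coordinates -/

section Oblique

variable {E : Type*} [NormedAddCommGroup E] [InnerProductSpace ℝ E]

/-- The coordinates `(y, t) ↦ y + t e` on `nᗮ × ℝ`. -/
def obliqueProd (n e : E) (q : (ℝ ∙ n)ᗮ × ℝ) : E := (q.1 : E) + q.2 • e

/-- The projection onto `nᗮ` along `e`, when `⟪n, e⟫ = 1`. -/
def obliqueProj (n e : E) (x : E) : (ℝ ∙ n)ᗮ :=
  (ℝ ∙ n)ᗮ.orthogonalProjectionOnto (x - ⟪n, x⟫_ℝ • e)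

lemma coe_obliqueProj {n e : E} (he : ⟪n, e⟫_ℝ = 1) (x : E) :
    (obliqueProj n e x : E) = x - ⟪n, x⟫_ℝ • e := by
  have hmem : x - ⟪n, x⟫_ℝ • e ∈ (ℝ ∙ n)ᗮ := by
    rw [Submodule.mem_orthogonal_singleton_iff_inner_right, inner_sub_right, inner_smul_right, he]
    ring
  rw [obliqueProj]
  exact congrArg Subtype.val
    (Submodule.orthogonalProjectionOnto_mem_subspace_eq_self (K := (ℝ ∙ n)ᗮ) ⟨_, hmem⟩)

lemma inner_coe_orthogonal_singleton (n : E) (y : (ℝ ∙ n)ᗮ) : ⟪n, (y : E)⟫_ℝ = 0 :=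
  Submodule.mem_orthogonal_singleton_iff_inner_right.1 y.2

lemma obliqueProj_obliqueProd {n e : E} (he : ⟪n, e⟫_ℝ = 1) (y : (ℝ ∙ n)ᗮ) (t : ℝ) :
    obliqueProj n e ((y : E) + t • e) = y := by
  ext
  rw [coe_obliqueProj he, inner_add_right, inner_smul_right, he, inner_coe_orthogonal_singleton]
  simp

lemma continuous_obliqueProj (n e : E) : Continuous (obliqueProj n e) := by
  unfold obliqueProj
  fun_prop

/-- A difference vector changes only by its `n`-component times `e`; on a nearly flat surface with
normal `n` this is a small fraction of its length. -/
lemma obliqueProj_sub_norm {n e : E} (he : ⟪n, e⟫_ℝ = 1) (x x' : E) :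
    |‖obliqueProj n e x - obliqueProj n e x'‖ - ‖x - x'‖| ≤ |⟪n, x - x'⟫_ℝ| * ‖e‖ := by
  have h : ‖obliqueProj n e x - obliqueProj n e x'‖
      = ‖(x - ⟪n, x⟫_ℝ • e) - (x' - ⟪n, x'⟫_ℝ • e)‖ := by
    rw [← coe_obliqueProj he, ← coe_obliqueProj he]
    rfl
  rw [h]
  refine (abs_norm_sub_norm_le _ _).trans ?_
  rw [← Real.norm_eq_abs, ← norm_smul, ← norm_neg, inner_sub_right]
  apply le_of_eq
  congr 1
  module

variable [FiniteDimensional ℝ E] [MeasurableSpace E] [BorelSpace E]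

lemma measurePreserving_obliqueProd_self {n : E} (hn : ‖n‖ = 1) :
    MeasurePreserving (obliqueProd n n) (volume.prod volume) volume := by
  have h1 := ((ℝ ∙ n).measurePreserving_measurableEquivProd (0 : E)).symm
  rw [InnerProductSpace.euclideanHausdorffMeasure_eq_volume] at h1
  have h2 := (LinearIsometryEquiv.toSpanUnitSingleton (𝕜 := ℝ) n hn).measurePreserving
  have h3 := h2.prod (MeasurePreserving.id (volume : Measure (ℝ ∙ n)ᗮ))
  have h4 := (h1.comp h3).comp (Measure.measurePreserving_swap (μ := (volume : Measure (ℝ ∙ n)ᗮ))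
    (ν := (volume : Measure ℝ)))
  have h5 : obliqueProd n n = ((ℝ ∙ n).measurableEquivProd (0 : E)).symm ∘
      Prod.map (LinearIsometryEquiv.toSpanUnitSingleton (𝕜 := ℝ) n hn) id ∘ Prod.swap := by
    funext q
    simp [obliqueProd, add_comm]
  rw [h5]
  exact h4

/-- Since `y + t e = (y + t (e - n)) + t n` with `e - n` orthogonal to `n`, the oblique coordinates
are the orthogonal ones composed with a shear. -/
lemma measurePreserving_obliqueProd {n e : E} (hn : ‖n‖ = 1) (he : ⟪n, e⟫_ℝ = 1) :
    MeasurePreserving (obliqueProd n e) (volume.prod volume) volume := by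
  have hb : e - n ∈ (ℝ ∙ n)ᗮ := by
    rw [Submodule.mem_orthogonal_singleton_iff_inner_right, inner_sub_right, he,
      real_inner_self_eq_norm_sq, hn]
    norm_num
  let b : (ℝ ∙ n)ᗮ := ⟨e - n, hb⟩
  have h1 : MeasurePreserving (fun p : ℝ × (ℝ ∙ n)ᗮ => (p.1, p.2 + p.1 • b))
      (volume.prod volume) (volume.prod volume) := by
    refine (MeasurePreserving.id (volume : Measure ℝ)).skew_product
      (g := fun (t : ℝ) (y : (ℝ ∙ n)ᗮ) => y + t • b) (by fun_prop) (ae_of_all _ fun t => ?_)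
    exact (measurePreserving_add_right _ _).map_eq
  have hs := Measure.measurePreserving_swap (μ := (volume : Measure (ℝ ∙ n)ᗮ))
    (ν := (volume : Measure ℝ))
  have hs' := Measure.measurePreserving_swap (μ := (volume : Measure ℝ))
    (ν := (volume : Measure (ℝ ∙ n)ᗮ))
  convert (measurePreserving_obliqueProd_self hn).comp (hs'.comp (h1.comp hs)) using 1
  ext q
  simp only [obliqueProd, Function.comp, Prod.swap, b, Submodule.coe_add, Submodule.coe_smul]
  module

lemma integral_obliqueProd {n e : E} (hn : ‖n‖ = 1) (he : ⟪n, e⟫_ℝ = 1) {f : E → ℝ}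
    (hf : Integrable f) :
    ∫ x, f x = ∫ y : (ℝ ∙ n)ᗮ, ∫ t : ℝ, f ((y : E) + t • e) := by
  have hm := measurePreserving_obliqueProd hn he
  have hf' : Integrable (f ∘ obliqueProd n e) (volume.prod volume) :=
    hm.integrable_comp_of_integrable hf
  rw [← hm.map_eq, integral_map hm.measurable.aemeasurable]
  · exact integral_prod _ hf'
  · rw [hm.map_eq]; exact hf.aestronglyMeasurable

end Oblique

/-! ### Hausdorff measure and almost isometric maps -/

section Lipschitz

variable {X Y : Type*} [EMetricSpace X] [MeasurableSpace X] [BorelSpace X]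
  [EMetricSpace Y] [MeasurableSpace Y] [BorelSpace Y]

lemma euclideanHausdorffMeasure_image_le {K : NNReal} {f : X → Y} {s : Set X}
    (hf : LipschitzOnWith K f s) (k : ℕ) : μHE[k] (f '' s) ≤ (K : ENNReal) ^ k * μHE[k] s := by
  rw [Measure.euclideanHausdorffMeasure_def, Measure.euclideanHausdorffMeasure_def]
  simp only [Measure.smul_apply, ENNReal.smul_def, smul_eq_mul]
  have := hf.hausdorffMeasure_image_le (d := k) (by positivity)
  rw [ENNReal.rpow_natCast] at this
  calc _ ≤ _ * ((K : ENNReal) ^ k * μH[k] s) := by gcongr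
    _ = _ := by ring

end Lipschitz

/-- Comparison of measures controls integrals of nonnegative functions only, so the positive and
negative parts of `f` are treated separately; their errors add up to `κ ∫ |f|`. -/
lemma abs_integral_sub_le_of_measure_le {α : Type*} [MeasurableSpace α] {m ν : Measure α}
    {κ : ℝ} (hκ : 0 ≤ κ) (hκ1 : κ ≤ 1) (h1 : ENNReal.ofReal (1 - κ) • m ≤ ν)
    (h2 : ν ≤ ENNReal.ofReal (1 + κ) • m) {f : α → ℝ} (hf : Integrable f m) :
    |∫ x, f x ∂ν - ∫ x, f x ∂m| ≤ κ * ∫ x, |f x| ∂m := by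
  have hfs : Integrable f (ENNReal.ofReal (1 + κ) • m) := hf.smul_measure ENNReal.ofReal_ne_top
  have hfν : Integrable f ν := hfs.mono_measure h2
  have key : ∀ g : α → ℝ, Integrable g m → (∀ x, 0 ≤ g x) →
      (1 - κ) * ∫ x, g x ∂m ≤ ∫ x, g x ∂ν ∧ ∫ x, g x ∂ν ≤ (1 + κ) * ∫ x, g x ∂m := by
    intro g hg h0
    have hgs : Integrable g (ENNReal.ofReal (1 + κ) • m) := hg.smul_measure ENNReal.ofReal_ne_top
    have a := integral_mono_measure h1 (ae_of_all _ h0) (hgs.mono_measure h2)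
    have b := integral_mono_measure h2 (ae_of_all _ h0) hgs
    rw [integral_smul_measure, ENNReal.toReal_ofReal (by linarith), smul_eq_mul] at a b
    exact ⟨a, b⟩
  have hp := key (fun x => max (f x) 0) hf.pos_part (fun x => le_max_right _ _)
  have hq := key (fun x => max (-f x) 0) hf.neg_part (fun x => le_max_right _ _)
  have e1 : ∀ μ : Measure α, Integrable f μ →
      ∫ x, f x ∂μ = ∫ x, max (f x) 0 ∂μ - ∫ x, max (-f x) 0 ∂μ := by
    intro μ hμ
    rw [← integral_sub hμ.pos_part hμ.neg_part]
    congr 1; ext x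
    rcases le_total (f x) 0 with h | h <;> simp [h]
  have e2 : ∫ x, |f x| ∂m = ∫ x, max (f x) 0 ∂m + ∫ x, max (-f x) 0 ∂m := by
    rw [← integral_add hf.pos_part hf.neg_part]
    congr 1; ext x
    rcases le_total (f x) 0 with h | h <;> simp [h, abs_of_nonneg, abs_of_nonpos]
  rw [e1 m hf, e1 ν hfν, e2, abs_le]
  constructor <;> nlinarith [hp.1, hp.2, hq.1, hq.2]

/-! ### Flat boundary patches -/

section Patch

variable {E : Type*} [NormedAddCommGroup E] [InnerProductSpace ℝ E]

/-- On `closedBall x₀ r`, the set `Ω` is `{ρ < 0}`, where `ρ - ⟪n, ·⟫` is `η`-Lipschitz. -/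
structure IsFlatPatch (Ω : Set E) (ρ : E → ℝ) (n x₀ : E) (r η : ℝ) : Prop where
  approx : ∀ x ∈ Metric.closedBall x₀ r, ∀ x' ∈ Metric.closedBall x₀ r,
    |ρ x - ρ x' - ⟪n, x - x'⟫_ℝ| ≤ η * ‖x - x'‖
  mem_iff : ∀ x ∈ Metric.closedBall x₀ r, x ∈ Ω ↔ ρ x < 0

/-- The zero set of `ρ` in `closedBall x₀ r`. -/
def zeroPatch (ρ : E → ℝ) (x₀ : E) (r : ℝ) : Set E := {x ∈ Metric.closedBall x₀ r | ρ x = 0}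

variable {Ω : Set E} {ρ : E → ℝ} {n x₀ e : E} {r η : ℝ}

lemma IsFlatPatch.continuousOn (hP : IsFlatPatch Ω ρ n x₀ r η) (hη : 0 ≤ η) :
    ContinuousOn ρ (Metric.closedBall x₀ r) := by
  have : LipschitzOnWith ⟨η + ‖n‖, by positivity⟩ ρ (Metric.closedBall x₀ r) := by
    refine LipschitzOnWith.of_dist_le_mul fun x hx y hy => ?_
    rw [Real.dist_eq, dist_eq_norm]
    have h1 := hP.approx x hx y hy
    have h2 := abs_real_inner_le_norm n (x - y)
    have h3 : |ρ x - ρ y| ≤ |ρ x - ρ y - ⟪n, x - y⟫_ℝ| + |⟪n, x - y⟫_ℝ| := by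
      simpa using abs_add_le (ρ x - ρ y - ⟪n, x - y⟫_ℝ) ⟪n, x - y⟫_ℝ
    change _ ≤ (η + ‖n‖) * _
    linarith
  exact this.continuousOn

lemma IsFlatPatch.obliqueProj_dist (hP : IsFlatPatch Ω ρ n x₀ r η) (he : ⟪n, e⟫_ℝ = 1)
    {x x' : E} (hx : x ∈ zeroPatch ρ x₀ r) (hx' : x' ∈ zeroPatch ρ x₀ r) :
    |‖obliqueProj n e x - obliqueProj n e x'‖ - ‖x - x'‖| ≤ η * ‖e‖ * ‖x - x'‖ := by
  refine (obliqueProj_sub_norm he x x').trans ?_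
  have h := hP.approx x hx.1 x' hx'.1
  rw [hx.2, hx'.2, sub_zero, zero_sub, abs_neg] at h
  calc |⟪n, x - x'⟫_ℝ| * ‖e‖ ≤ (η * ‖x - x'‖) * ‖e‖ := by gcongr
    _ = _ := by ring

lemma IsFlatPatch.lipschitzOn_obliqueProj (hP : IsFlatPatch Ω ρ n x₀ r η) (he : ⟪n, e⟫_ℝ = 1)
    (hη : 0 ≤ η) :
    LipschitzOnWith (1 + η * ‖e‖).toNNReal (obliqueProj n e) (zeroPatch ρ x₀ r) := by
  refine LipschitzOnWith.of_dist_le_mul fun x hx y hy => ?_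
  rw [dist_eq_norm, dist_eq_norm, Real.coe_toNNReal _ (by positivity)]
  linarith [(abs_le.1 (hP.obliqueProj_dist he hx hy)).2]

lemma IsFlatPatch.injOn_obliqueProj (hP : IsFlatPatch Ω ρ n x₀ r η) (he : ⟪n, e⟫_ℝ = 1)
    (hη1 : η * ‖e‖ < 1) : Set.InjOn (obliqueProj n e) (zeroPatch ρ x₀ r) := by
  intro x hx y hy hxy
  have h := (abs_le.1 (hP.obliqueProj_dist he hx hy)).1
  rw [hxy, sub_self, norm_zero] at h
  have : ‖x - y‖ ≤ 0 := by nlinarith [norm_nonneg (x - y)]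
  exact sub_eq_zero.1 (norm_le_zero_iff.1 this)

/-- The inverse of the oblique projection of the patch. -/
def patchLift (ρ : E → ℝ) (n e x₀ : E) (r : ℝ) : (ℝ ∙ n)ᗮ → E :=
  Function.invFunOn (obliqueProj n e) (zeroPatch ρ x₀ r)

lemma patchLift_mem {y : (ℝ ∙ n)ᗮ} (hy : y ∈ obliqueProj n e '' zeroPatch ρ x₀ r) :
    patchLift ρ n e x₀ r y ∈ zeroPatch ρ x₀ r ∧ obliqueProj n e (patchLift ρ n e x₀ r y) = y :=
  ⟨Function.invFunOn_mem hy, Function.invFunOn_eq hy⟩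

lemma IsFlatPatch.patchLift_obliqueProj (hP : IsFlatPatch Ω ρ n x₀ r η) (he : ⟪n, e⟫_ℝ = 1)
    (hη1 : η * ‖e‖ < 1) {x : E} (hx : x ∈ zeroPatch ρ x₀ r) :
    patchLift ρ n e x₀ r (obliqueProj n e x) = x := by
  have h := patchLift_mem (n := n) (e := e) (Set.mem_image_of_mem _ hx)
  exact hP.injOn_obliqueProj he hη1 h.1 hx h.2

lemma IsFlatPatch.lipschitzOn_patchLift (hP : IsFlatPatch Ω ρ n x₀ r η) (he : ⟪n, e⟫_ℝ = 1)
    (hη1 : η * ‖e‖ < 1) :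
    LipschitzOnWith (1 - η * ‖e‖)⁻¹.toNNReal (patchLift ρ n e x₀ r)
      (obliqueProj n e '' zeroPatch ρ x₀ r) := by
  refine LipschitzOnWith.of_dist_le_mul fun x hx y hy => ?_
  have h0 : 0 < 1 - η * ‖e‖ := by linarith
  have h := (abs_le.1 (hP.obliqueProj_dist he (patchLift_mem hx).1 (patchLift_mem hy).1)).1
  rw [(patchLift_mem hx).2, (patchLift_mem hy).2] at h
  rw [dist_eq_norm, dist_eq_norm, Real.coe_toNNReal _ (by positivity), inv_mul_eq_div,
    le_div_iff₀ h0]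
  linarith

/-- Along the line through a zero of `ρ`, `ρ (x + t e)` differs from `t` by at most `η ‖e‖ |t|`,
which is less than `|t|` for `t ≠ 0`; hence `ρ` has the sign of `t`. -/
lemma IsFlatPatch.mem_iff_neg (hP : IsFlatPatch Ω ρ n x₀ r η) (he : ⟪n, e⟫_ℝ = 1)
    (hη1 : η * ‖e‖ < 1) {x : E} (hx : x ∈ zeroPatch ρ x₀ r) {t : ℝ}
    (ht : x + t • e ∈ Metric.closedBall x₀ r) : x + t • e ∈ Ω ↔ t < 0 := by
  rw [hP.mem_iff _ ht]
  have h := hP.approx _ ht x hx.1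
  rw [hx.2, sub_zero, add_sub_cancel_left, inner_smul_right, he, mul_one, norm_smul,
    Real.norm_eq_abs] at h
  have h' := abs_le.1 h
  constructor
  · intro hneg
    by_contra hcon
    rw [abs_of_nonneg (not_lt.1 hcon)] at h'
    rcases eq_or_lt_of_le (not_lt.1 hcon) with h0 | h0
    · rw [← h0, zero_smul, add_zero, hx.2] at hneg
      exact lt_irrefl _ hneg
    · nlinarith
  · intro hneg
    rw [abs_of_neg hneg] at h'
    nlinarith

lemma hasCompactSupport_line [FiniteDimensional ℝ E] {f : E → ℝ} (hf : HasCompactSupport f)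
    (he : e ≠ 0) (x : E) : HasCompactSupport fun t : ℝ => f (x + t • e) :=
  hf.comp_isClosedEmbedding
    ((Homeomorph.addLeft x).isClosedEmbedding.comp (isClosedEmbedding_smul_left (𝕜 := ℝ) he))

lemma hasDerivAt_line {f : E → ℝ} (hf : ContDiff ℝ 1 f) (x : E) (t : ℝ) :
    HasDerivAt (fun t : ℝ => f (x + t • e)) (fderiv ℝ f (x + t • e) e) t := by
  have h1 : HasDerivAt (fun t : ℝ => x + t • e) e t := by
    simpa using ((hasDerivAt_id t).smul_const e).const_add x
  exact ((hf.differentiable one_ne_zero _).hasFDerivAt).comp_hasDerivAt t h1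

lemma fderiv_eq_zero_of_notMem_closedBall {f : E → ℝ} (hK : tsupport f ⊆ Metric.closedBall x₀ r)
    {x : E} (hx : x ∉ Metric.closedBall x₀ r) : fderiv ℝ f x = 0 :=
  image_eq_zero_of_notMem_tsupport fun h => hx (hK (tsupport_fderiv_subset ℝ h))

variable [FiniteDimensional ℝ E]

lemma IsFlatPatch.integral_line_of_mem (hP : IsFlatPatch Ω ρ n x₀ r η) (he : ⟪n, e⟫_ℝ = 1)
    (hη1 : η * ‖e‖ < 1) {f : E → ℝ} (hf : ContDiff ℝ 1 f)
    (hK : tsupport f ⊆ Metric.closedBall x₀ r) {x : E} (hx : x ∈ zeroPatch ρ x₀ r) :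
    ∫ t : ℝ, Ω.indicator (fun x => fderiv ℝ f x e) (x + t • e) = f x := by
  classical
  have he0 : e ≠ 0 := by rintro rfl; simp at he
  have hc : HasCompactSupport f :=
    HasCompactSupport.of_support_subset_isCompact (isCompact_closedBall x₀ r)
      ((subset_tsupport f).trans hK)
  have h1 : (fun t : ℝ => Ω.indicator (fun x => fderiv ℝ f x e) (x + t • e)) =
      (Set.Iio (0 : ℝ)).indicator (deriv fun t : ℝ => f (x + t • e)) := by
    ext t
    rw [Set.indicator_apply, Set.indicator_apply, (hasDerivAt_line hf x t).deriv]
    by_cases ht : x + t • e ∈ Metric.closedBall x₀ r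
    · simp only [hP.mem_iff_neg he hη1 hx ht, Set.mem_Iio]
    · simp [fderiv_eq_zero_of_notMem_closedBall hK ht]
  have h2 : ContDiff ℝ 1 fun t : ℝ => f (x + t • e) :=
    hf.comp (contDiff_const.add (contDiff_id.smul contDiff_const))
  rw [h1, integral_indicator measurableSet_Iio, ← integral_Iic_eq_integral_Iio,
    HasCompactSupport.integral_Iic_deriv_eq h2 (hasCompactSupport_line hc he0 x)]
  simp

/-- The line cuts the ball in an interval on which `ρ` has no zero, hence a constant sign. The part
of the line that meets the support is therefore entirely inside `Ω`, where a compactly supported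
derivative integrates to zero, or entirely outside. -/
lemma IsFlatPatch.integral_line_of_forall_notMem (hP : IsFlatPatch Ω ρ n x₀ r η)
    (he : ⟪n, e⟫_ℝ = 1) (hη : 0 ≤ η) {f : E → ℝ} (hf : ContDiff ℝ 1 f)
    (hK : tsupport f ⊆ Metric.closedBall x₀ r) {x : E}
    (hx : ∀ t : ℝ, x + t • e ∉ zeroPatch ρ x₀ r) :
    ∫ t : ℝ, Ω.indicator (fun x => fderiv ℝ f x e) (x + t • e) = 0 := by
  classical
  have he0 : e ≠ 0 := by rintro rfl; simp at he
  have hc : HasCompactSupport f :=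
    HasCompactSupport.of_support_subset_isCompact (isCompact_closedBall x₀ r)
      ((subset_tsupport f).trans hK)
  set I : Set ℝ := {t | x + t • e ∈ Metric.closedBall x₀ r} with hI
  have hconv : Convex ℝ I := by
    have : I = AffineMap.lineMap (k := ℝ) x (x + e) ⁻¹' Metric.closedBall x₀ r := by
      ext t
      simp [hI, AffineMap.lineMap_apply, add_comm]
    rw [this]
    exact (convex_closedBall x₀ r).affine_preimage _
  have hcont : ContinuousOn (fun t : ℝ => ρ (x + t • e)) I :=
    (hP.continuousOn hη).comp (by fun_prop) fun t ht => ht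
  have hne : ∀ t ∈ I, ρ (x + t • e) ≠ 0 := fun t ht h0 => hx t ⟨ht, h0⟩
  have hsign : (∀ t ∈ I, ρ (x + t • e) < 0) ∨ (∀ t ∈ I, 0 ≤ ρ (x + t • e)) := by
    by_contra hcon
    push Not at hcon
    obtain ⟨⟨a, ha, ha0⟩, ⟨b, hb, hb0⟩⟩ := hcon
    obtain ⟨c, hcI, hc0⟩ := hconv.isPreconnected.intermediate_value hb ha hcont
      ⟨hb0.le, ha0⟩
    exact hne c hcI hc0
  rcases hsign with hs | hs
  · have h1 : (fun t : ℝ => Ω.indicator (fun x => fderiv ℝ f x e) (x + t • e)) =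
        fun t : ℝ => fderiv ℝ f (x + t • e) e := by
      ext t
      rw [Set.indicator_apply]
      by_cases ht : x + t • e ∈ Metric.closedBall x₀ r
      · rw [if_pos ((hP.mem_iff _ ht).2 (hs t ht))]
      · simp [fderiv_eq_zero_of_notMem_closedBall hK ht]
    have h2 : ContDiff ℝ 1 fun t : ℝ => f (x + t • e) :=
      hf.comp (contDiff_const.add (contDiff_id.smul contDiff_const))
    have hcs := hasCompactSupport_line hc he0 x
    have h3 : (fun t : ℝ => fderiv ℝ f (x + t • e) e) = deriv fun t : ℝ => f (x + t • e) := by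
      ext t; rw [(hasDerivAt_line hf x t).deriv]
    rw [h1]
    refine integral_eq_zero_of_hasDerivAt_of_integrable (fun t => hasDerivAt_line hf x t) ?_
      (h2.continuous.integrable_of_hasCompactSupport hcs)
    rw [h3]
    exact (h2.continuous_deriv le_rfl).integrable_of_hasCompactSupport hcs.deriv
  · have h1 : (fun t : ℝ => Ω.indicator (fun x => fderiv ℝ f x e) (x + t • e)) = fun _ => 0 := by
      ext t
      rw [Set.indicator_apply]
      by_cases ht : x + t • e ∈ Metric.closedBall x₀ r
      · rw [if_neg (fun h => absurd ((hP.mem_iff _ ht).1 h) (not_lt.2 (hs t ht)))]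
      · simp [fderiv_eq_zero_of_notMem_closedBall hK ht]
    rw [h1, integral_zero]

variable [MeasurableSpace E] [BorelSpace E]

/-- Fubini in oblique coordinates: each line in direction `e` meets the patch at most once, and the
fundamental theorem of calculus on it leaves the value of `f` at that point, or zero. -/
lemma IsFlatPatch.integral_fderiv (hP : IsFlatPatch Ω ρ n x₀ r η) (hΩ : MeasurableSet Ω)
    (hn : ‖n‖ = 1) (he : ⟪n, e⟫_ℝ = 1) (hη : 0 ≤ η) (hη1 : η * ‖e‖ < 1) {f : E → ℝ}
    (hf : ContDiff ℝ 1 f) (hK : tsupport f ⊆ Metric.closedBall x₀ r) :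
    ∫ x in Ω, fderiv ℝ f x e = ∫ y : (ℝ ∙ n)ᗮ,
      (obliqueProj n e '' zeroPatch ρ x₀ r).indicator (f ∘ patchLift ρ n e x₀ r) y := by
  have hc : HasCompactSupport f :=
    HasCompactSupport.of_support_subset_isCompact (isCompact_closedBall x₀ r)
      ((subset_tsupport f).trans hK)
  have hint : Integrable (Ω.indicator fun x => fderiv ℝ f x e) := by
    refine Integrable.indicator ?_ hΩ
    refine Continuous.integrable_of_hasCompactSupport ?_ ?_
    · exact (hf.continuous_fderiv one_ne_zero).clm_apply continuous_const
    · exact hc.fderiv_apply (𝕜 := ℝ) e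
  rw [← integral_indicator hΩ, integral_obliqueProd hn he hint]
  congr 1
  ext y
  by_cases hy : y ∈ obliqueProj n e '' zeroPatch ρ x₀ r
  · rw [Set.indicator_of_mem hy]
    obtain ⟨x, hx, rfl⟩ := hy
    -- Translating `t` by `⟪n, x⟫` moves the origin of the line from the hyperplane to the boundary
    -- point `x`.
    rw [Function.comp_apply, hP.patchLift_obliqueProj he hη1 hx,
      ← hP.integral_line_of_mem he hη1 hf hK hx, coe_obliqueProj he,
      ← integral_add_right_eq_self _ ⟪n, x⟫_ℝ]
    congr 1
    ext t
    congr 1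
    module
  · rw [Set.indicator_of_notMem hy]
    refine hP.integral_line_of_forall_notMem he hη hf hK fun t ht => hy ⟨_, ht, ?_⟩
    exact obliqueProj_obliqueProd he y t

end Patch

/-! ### Hausdorff measure on a flat patch compared with Lebesgue measure on the hyperplane -/

section PatchMeasure

variable {E : Type*} [NormedAddCommGroup E] [InnerProductSpace ℝ E] [FiniteDimensional ℝ E]
  {Ω : Set E} {ρ : E → ℝ} {n x₀ e : E} {r η : ℝ}

lemma IsFlatPatch.isCompact_zeroPatch (hP : IsFlatPatch Ω ρ n x₀ r η) (hη : 0 ≤ η) :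
    IsCompact (zeroPatch ρ x₀ r) :=
  (isCompact_closedBall x₀ r).of_isClosed_subset
    ((hP.continuousOn hη).preimage_isClosed_of_isClosed Metric.isClosed_closedBall
      (isClosed_singleton (x := (0 : ℝ)))) fun _ hx => hx.1

lemma IsFlatPatch.isCompact_image (hP : IsFlatPatch Ω ρ n x₀ r η) (hη : 0 ≤ η) :
    IsCompact (obliqueProj n e '' zeroPatch ρ x₀ r) :=
  (hP.isCompact_zeroPatch hη).image (continuous_obliqueProj n e)

variable [MeasurableSpace E] [BorelSpace E] {k : ℕ}

lemma volume_orthogonal_singleton (hk : Module.finrank ℝ (ℝ ∙ n)ᗮ = k) :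
    (volume : Measure (ℝ ∙ n)ᗮ) = μHE[k] := by
  rw [← hk, InnerProductSpace.euclideanHausdorffMeasure_eq_volume]

/-- The lift is Lipschitz with constant `(1 - η‖e‖)⁻¹`. An arbitrary `A` is allowed so that the
bound compares measures, not just total masses. -/
lemma IsFlatPatch.measure_inter_le (hP : IsFlatPatch Ω ρ n x₀ r η)
    (hk : Module.finrank ℝ (ℝ ∙ n)ᗮ = k) (he : ⟪n, e⟫_ℝ = 1) (hη1 : η * ‖e‖ < 1)
    (A : Set (ℝ ∙ n)ᗮ) :
    (μHE[k] : Measure E) (obliqueProj n e ⁻¹' A ∩ zeroPatch ρ x₀ r) ≤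
      ((1 - η * ‖e‖)⁻¹.toNNReal : ENNReal) ^ k *
        volume (A ∩ obliqueProj n e '' zeroPatch ρ x₀ r) := by
  rw [volume_orthogonal_singleton hk]
  refine le_trans (measure_mono ?_) (euclideanHausdorffMeasure_image_le
    ((hP.lipschitzOn_patchLift he hη1).mono Set.inter_subset_right) k)
  rintro x ⟨hxA, hx⟩
  exact ⟨_, ⟨hxA, Set.mem_image_of_mem _ hx⟩, hP.patchLift_obliqueProj he hη1 hx⟩

lemma IsFlatPatch.le_measure_inter (hP : IsFlatPatch Ω ρ n x₀ r η)
    (hk : Module.finrank ℝ (ℝ ∙ n)ᗮ = k) (he : ⟪n, e⟫_ℝ = 1) (hη : 0 ≤ η)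
    (A : Set (ℝ ∙ n)ᗮ) :
    volume (A ∩ obliqueProj n e '' zeroPatch ρ x₀ r) ≤
      ((1 + η * ‖e‖).toNNReal : ENNReal) ^ k *
        (μHE[k] : Measure E) (obliqueProj n e ⁻¹' A ∩ zeroPatch ρ x₀ r) := by
  rw [volume_orthogonal_singleton hk]
  refine le_trans (measure_mono ?_) (euclideanHausdorffMeasure_image_le
    ((hP.lipschitzOn_obliqueProj he hη).mono Set.inter_subset_right) k)
  rintro _ ⟨hxA, ⟨x, hx, rfl⟩⟩
  exact ⟨x, ⟨hxA, hx⟩, rfl⟩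

lemma IsFlatPatch.measure_zeroPatch_lt_top (hP : IsFlatPatch Ω ρ n x₀ r η)
    (hk : Module.finrank ℝ (ℝ ∙ n)ᗮ = k) (he : ⟪n, e⟫_ℝ = 1) (hη : 0 ≤ η) (hη1 : η * ‖e‖ < 1) :
    (μHE[k] : Measure E) (zeroPatch ρ x₀ r) < ⊤ := by
  have h := hP.measure_inter_le hk he hη1 Set.univ
  rw [Set.preimage_univ, Set.univ_inter, Set.univ_inter] at h
  refine h.trans_lt (ENNReal.mul_lt_top ?_ (hP.isCompact_image hη).measure_lt_top)
  exact ENNReal.pow_lt_top ENNReal.coe_lt_top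

/-- On a flat patch, the integral of an oblique derivative over `Ω` is, up to a small relative
error, the integral over the boundary patch with respect to the Hausdorff measure. -/
lemma IsFlatPatch.abs_integral_fderiv_sub_le (hP : IsFlatPatch Ω ρ n x₀ r η)
    (hk : Module.finrank ℝ (ℝ ∙ n)ᗮ = k) (hΩ : MeasurableSet Ω)
    (hn : ‖n‖ = 1) (he : ⟪n, e⟫_ℝ = 1) (hη : 0 ≤ η) (hη1 : η * ‖e‖ < 1) {κ : ℝ} (hκ : 0 ≤ κ)
    (hκ1 : κ ≤ 1) (h1 : (1 + η * ‖e‖) ^ k ≤ 1 + κ) (h2 : 1 - κ ≤ (1 - η * ‖e‖) ^ k) {f : E → ℝ}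
    (hf : ContDiff ℝ 1 f) (hK : tsupport f ⊆ Metric.closedBall x₀ r) :
    |(∫ x in Ω, fderiv ℝ f x e) - ∫ x in zeroPatch ρ x₀ r, f x ∂μHE[k]| ≤
      κ * ∫ x in zeroPatch ρ x₀ r, |f x| ∂μHE[k] := by
  have hc : HasCompactSupport f :=
    HasCompactSupport.of_support_subset_isCompact (isCompact_closedBall x₀ r)
      ((subset_tsupport f).trans hK)
  set S := zeroPatch ρ x₀ r with hS
  set g : (ℝ ∙ n)ᗮ → ℝ :=
    (obliqueProj n e '' S).indicator (f ∘ patchLift ρ n e x₀ r) with hg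
  have hSc : IsCompact S := hP.isCompact_zeroPatch hη
  have hIc : IsCompact (obliqueProj n e '' S) := hP.isCompact_image hη
  have hπ : Measurable (obliqueProj n e) := (continuous_obliqueProj n e).measurable
  -- Both integrals are carried to the hyperplane, where the pushed-forward surface measure `m` and
  -- Lebesgue measure `ν` on the image agree up to the factors `1 ± κ`.
  set m : Measure (ℝ ∙ n)ᗮ := Measure.map (obliqueProj n e) (μHE[k].restrict S) with hm
  set ν : Measure (ℝ ∙ n)ᗮ := volume.restrict (obliqueProj n e '' S) with hν
  have hmA : ∀ A, MeasurableSet A → m A = (μHE[k] : Measure E) (obliqueProj n e ⁻¹' A ∩ S) := by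
    intro A hA
    rw [hm, Measure.map_apply hπ hA, Measure.restrict_apply (hπ hA)]
  have hνA : ∀ A, MeasurableSet A → ν A = volume (A ∩ obliqueProj n e '' S) :=
    fun A hA => Measure.restrict_apply hA
  have hpos : 0 < 1 - η * ‖e‖ := by linarith
  have hle1 : ENNReal.ofReal (1 - κ) • m ≤ ν := by
    refine Measure.le_iff.2 fun A hA => ?_
    rw [Measure.smul_apply, smul_eq_mul, hmA A hA, hνA A hA]
    calc ENNReal.ofReal (1 - κ) * (μHE[k] : Measure E) (obliqueProj n e ⁻¹' A ∩ S)
        ≤ ENNReal.ofReal ((1 - η * ‖e‖) ^ k) * (((1 - η * ‖e‖)⁻¹.toNNReal : ENNReal) ^ k *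
          volume (A ∩ obliqueProj n e '' S)) := by
          gcongr
          exact hP.measure_inter_le hk he hη1 A
      _ = volume (A ∩ obliqueProj n e '' S) := by
          rw [← mul_assoc, ENNReal.ofReal_pow hpos.le]
          change ENNReal.ofReal (1 - η * ‖e‖) ^ k * ENNReal.ofReal (1 - η * ‖e‖)⁻¹ ^ k * _ = _
          rw [← mul_pow, ← ENNReal.ofReal_mul hpos.le, mul_inv_cancel₀ hpos.ne']
          simp
  have hle2 : ν ≤ ENNReal.ofReal (1 + κ) • m := by
    refine Measure.le_iff.2 fun A hA => ?_
    rw [Measure.smul_apply, smul_eq_mul, hmA A hA, hνA A hA]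
    refine (hP.le_measure_inter hk he hη A).trans ?_
    gcongr
    change ENNReal.ofReal (1 + η * ‖e‖) ^ k ≤ _
    rw [← ENNReal.ofReal_pow (by positivity)]
    exact ENNReal.ofReal_le_ofReal h1
  have hgm : Measurable g := by
    classical
    rw [hg, ← Set.piecewise_eq_indicator]
    refine ContinuousOn.measurable_piecewise ?_ continuousOn_const hIc.measurableSet
    exact hf.continuous.comp_continuousOn (hP.lipschitzOn_patchLift he hη1).continuousOn
  have : IsFiniteMeasure (μHE[k].restrict S : Measure E) :=
    ⟨by simpa using hP.measure_zeroPatch_lt_top hk he hη hη1⟩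
  have : IsFiniteMeasure m := by rw [hm]; infer_instance
  obtain ⟨C, hC⟩ := hc.exists_bound_of_continuous hf.continuous
  have hgi : Integrable g m := by
    refine Integrable.of_bound hgm.aestronglyMeasurable C (ae_of_all _ fun y => ?_)
    refine (norm_indicator_le_norm_self _ _).trans (hC _)
  have hgπ : ∀ x ∈ S, g (obliqueProj n e x) = f x := fun x hx => by
    rw [hg, Set.indicator_of_mem (Set.mem_image_of_mem _ hx), Function.comp_apply,
      hP.patchLift_obliqueProj he hη1 hx]
  have e1 : ∫ x in S, f x ∂μHE[k] = ∫ y, g y ∂m := by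
    rw [hm, integral_map hπ.aemeasurable hgm.aestronglyMeasurable]
    exact setIntegral_congr_fun hSc.measurableSet fun x hx => (hgπ x hx).symm
  have e2 : ∫ x in S, |f x| ∂μHE[k] = ∫ y, |g y| ∂m := by
    rw [hm, integral_map hπ.aemeasurable (by fun_prop)]
    exact setIntegral_congr_fun hSc.measurableSet fun x hx => by simp only [hgπ x hx]
  have e3 : ∫ x in Ω, fderiv ℝ f x e = ∫ y, g y ∂ν := by
    rw [hP.integral_fderiv hΩ hn he hη hη1 hf hK, hν, ← integral_indicator hIc.measurableSet,
      hg, Set.indicator_indicator, Set.inter_self]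
  rw [e1, e2, e3]
  exact abs_integral_sub_le_of_measure_le hκ hκ1 hle1 hle2 hgi

end PatchMeasure

/-! ### Outward normals of smooth domains -/

open Filter Topology

lemma eventually_neg_of_fderiv_neg {E : Type*} [NormedAddCommGroup E] [NormedSpace ℝ E]
    {ρ : E → ℝ} {ρ' : E →L[ℝ] ℝ} {x w : E} (h : HasFDerivAt ρ ρ' x) (h0 : ρ x = 0)
    (hw : ρ' w < 0) : ∀ᶠ t : ℝ in 𝓝[>] 0, ρ (x + t • w) < 0 := by
  have h1 : HasDerivAt (fun t : ℝ => x + t • w) w 0 := by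
    simpa using ((hasDerivAt_id (0 : ℝ)).smul_const w).const_add x
  have h2 : HasDerivAt (fun t : ℝ => ρ (x + t • w)) (ρ' w) 0 := by
    refine HasFDerivAt.comp_hasDerivAt (0 : ℝ) ?_ h1
    simpa using h
  have h3 := (hasDerivAt_iff_tendsto_slope.1 h2).eventually (eventually_lt_nhds hw)
  have h4 : ∀ᶠ t : ℝ in 𝓝[>] 0, slope (fun t : ℝ => ρ (x + t • w)) 0 t < 0 :=
    h3.filter_mono (nhdsWithin_mono _ fun t (ht : 0 < t) => ht.ne')
  filter_upwards [h4, self_mem_nhdsWithin] with t ht htpos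
  rw [slope_def_field] at ht
  simp only [zero_smul, add_zero, h0, sub_zero] at ht
  by_contra hcon
  exact absurd ht (not_lt.2 (div_nonneg (not_lt.1 hcon) (le_of_lt htpos)))

variable {d : ℕ} {Ω U : Set (Euc d)} {ρ : Euc d → ℝ} {x : Euc d}

lemma inner_gradient (f : Euc d → ℝ) (x w : Euc d) : ⟪gradient f x, w⟫_ℝ = fderiv ℝ f x w :=
  InnerProductSpace.toDual_symm_apply

lemma IsDefiningFunctionOn.contDiffAt (h : IsDefiningFunctionOn Ω U ρ) (hx : x ∈ U) :
    ContDiffAt ℝ ∞ ρ x :=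
  h.contDiffOn.contDiffAt (h.isOpen.mem_nhds hx)

lemma IsDefiningFunctionOn.hasFDerivAt (h : IsDefiningFunctionOn Ω U ρ) (hx : x ∈ U) :
    HasFDerivAt ρ (fderiv ℝ ρ x) x :=
  ((h.contDiffAt hx).differentiableAt (by simp)).hasFDerivAt

lemma IsDefiningFunctionOn.eq_zero (h : IsDefiningFunctionOn Ω U ρ) (hΩ : IsOpen Ω) (hx : x ∈ U)
    (hxf : x ∈ frontier Ω) : ρ x = 0 := by
  rw [hΩ.frontier_eq] at hxf
  refine le_antisymm ?_ (not_lt.1 fun hlt => hxf.2 ((h.mem_iff x hx).2 hlt))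
  by_contra hcon
  have hev : ∀ᶠ y in 𝓝 x, 0 < ρ y :=
    (h.contDiffAt hx).continuousAt.eventually (eventually_gt_nhds (not_le.1 hcon))
  have hfr := mem_closure_iff_frequently.1 hxf.1
  obtain ⟨y, hy, hy1, hy2⟩ := (hfr.and_eventually (hev.and (h.isOpen.mem_nhds hx))).exists
  exact absurd ((h.mem_iff y hy2).1 hy) (not_lt.2 hy1.le)

lemma eventually_ray_mem {V : Set (Euc d)} (hV : IsOpen V) (hx : x ∈ V) (w : Euc d) :
    ∀ᶠ t : ℝ in 𝓝[>] 0, x + t • w ∈ V := by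
  have hc : Tendsto (fun t : ℝ => x + t • w) (𝓝 0) (𝓝 x) := by
    have : Continuous fun t : ℝ => x + t • w := by fun_prop
    simpa using this.tendsto 0
  exact (hc.eventually (hV.mem_nhds hx)).filter_mono nhdsWithin_le_nhds

/-- Moving from `x` along `-∇ρ` makes `ρ` negative at once, so `x` is a limit of points of `Ω`. -/
lemma IsDefiningFunctionOn.mem_frontier (h : IsDefiningFunctionOn Ω U ρ) (hΩ : IsOpen Ω)
    (hx : x ∈ U) (h0 : ρ x = 0) : x ∈ frontier Ω := by
  rw [hΩ.frontier_eq]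
  refine ⟨?_, fun hm => absurd ((h.mem_iff x hx).1 hm) (by simp [h0])⟩
  have hneg : fderiv ℝ ρ x (-gradient ρ x) < 0 := by
    rw [← inner_gradient, inner_neg_right, real_inner_self_eq_norm_sq]
    have := norm_pos_iff.2 (h.gradient_ne_zero x hx)
    simp only [Left.neg_neg_iff]
    positivity
  have h1 := eventually_neg_of_fderiv_neg (h.hasFDerivAt hx) h0 hneg
  have h2 := eventually_ray_mem h.isOpen hx (-gradient ρ x)
  have hc : Tendsto (fun t : ℝ => x + t • (-gradient ρ x)) (𝓝[>] 0) (𝓝 x) := by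
    have : Continuous fun t : ℝ => x + t • (-gradient ρ x) := by fun_prop
    simpa using (this.tendsto 0).mono_left nhdsWithin_le_nhds
  refine mem_closure_of_tendsto hc ?_
  filter_upwards [h1, h2] with t ht1 ht2
  exact (h.mem_iff _ ht2).2 ht1

/-- If the two unit normals differed, their difference `w` would satisfy `dρ(w) < 0 < dρ'(w)`;
points just after `x` on the ray along `w` would be inside `Ω` according to `ρ` and outside
according to `ρ'`. -/
lemma unit_normal_unique {U' : Set (Euc d)} {ρ' : Euc d → ℝ} (hΩ : IsOpen Ω)
    (h : IsDefiningFunctionOn Ω U ρ) (h' : IsDefiningFunctionOn Ω U' ρ') (hx : x ∈ U)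
    (hx' : x ∈ U') (hf : x ∈ frontier Ω) :
    ‖gradient ρ x‖⁻¹ • gradient ρ x = ‖gradient ρ' x‖⁻¹ • gradient ρ' x := by
  set a := gradient ρ x with ha
  set b := gradient ρ' x with hb
  have hna : 0 < ‖a‖ := norm_pos_iff.2 (h.gradient_ne_zero x hx)
  have hnb : 0 < ‖b‖ := norm_pos_iff.2 (h'.gradient_ne_zero x hx')
  have hca : ‖‖a‖⁻¹ • a‖ = 1 := by rw [norm_smul, norm_inv, norm_norm, inv_mul_cancel₀ hna.ne']
  have hcb : ‖‖b‖⁻¹ • b‖ = 1 := by rw [norm_smul, norm_inv, norm_norm, inv_mul_cancel₀ hnb.ne']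
  by_contra hne
  have hlt := (inner_lt_one_iff_real_of_norm_eq_one hca hcb).2 hne
  rw [real_inner_smul_left, real_inner_smul_right] at hlt
  set w := ‖b‖⁻¹ • b - ‖a‖⁻¹ • a with hw
  have hwa : fderiv ℝ ρ x w < 0 := by
    rw [← inner_gradient, ← ha, hw, inner_sub_right, real_inner_smul_right,
      real_inner_smul_right, real_inner_self_eq_norm_sq]
    have : ‖a‖⁻¹ * ‖a‖ ^ 2 = ‖a‖ := by field_simp
    rw [this]
    have e : ‖a‖⁻¹ * (‖b‖⁻¹ * ⟪a, b⟫_ℝ) * ‖a‖ = ‖b‖⁻¹ * ⟪a, b⟫_ℝ := by field_simp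
    nlinarith
  have hwb : fderiv ℝ (fun y => -ρ' y) x w < 0 := by
    rw [fderiv_fun_neg, neg_apply,
      ← inner_gradient, ← hb, hw, inner_sub_right, real_inner_smul_right,
      real_inner_smul_right, real_inner_self_eq_norm_sq, real_inner_comm]
    have : ‖b‖⁻¹ * ‖b‖ ^ 2 = ‖b‖ := by field_simp
    rw [this]
    have e : ‖a‖⁻¹ * (‖b‖⁻¹ * ⟪a, b⟫_ℝ) * ‖b‖ = ‖a‖⁻¹ * ⟪a, b⟫_ℝ := by field_simp
    nlinarith
  have h1 := eventually_neg_of_fderiv_neg (h.hasFDerivAt hx) (h.eq_zero hΩ hx hf) hwa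
  have h2 := eventually_neg_of_fderiv_neg
    (((h'.contDiffAt hx').differentiableAt (by simp)).fun_neg.hasFDerivAt)
    (by simp [h'.eq_zero hΩ hx' hf]) hwb
  obtain ⟨t, ⟨ht1, ht2⟩, ht3, ht4⟩ := ((h1.and h2).and
    ((eventually_ray_mem h.isOpen hx w).and (eventually_ray_mem h'.isOpen hx' w))).exists
  have := (h'.mem_iff _ ht4).1 ((h.mem_iff _ ht3).2 ht1)
  linarith

lemma IsBoundedSmoothDomain.isOutwardUnitNormal (hΩ : IsBoundedSmoothDomain Ω)
    (hx : x ∈ frontier Ω) : IsOutwardUnitNormal Ω x (outwardNormal Ω x) := by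
  obtain ⟨U, ρ, hxU, h⟩ := hΩ.smooth_boundary x hx
  have hex : ∃ n, IsOutwardUnitNormal Ω x n := ⟨_, U, ρ, hxU, h, rfl⟩
  rw [outwardNormal, dif_pos hex]
  exact hex.choose_spec

lemma IsDefiningFunctionOn.outwardNormal_eq (h : IsDefiningFunctionOn Ω U ρ)
    (hΩ : IsBoundedSmoothDomain Ω) (hx : x ∈ U) (hf : x ∈ frontier Ω) :
    outwardNormal Ω x = ‖gradient ρ x‖⁻¹ • gradient ρ x := by
  obtain ⟨U', ρ', hxU', h', he⟩ := hΩ.isOutwardUnitNormal hf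
  rw [he, unit_normal_unique hΩ.isOpen h' h hxU' hx hf]

lemma IsBoundedSmoothDomain.norm_outwardNormal (hΩ : IsBoundedSmoothDomain Ω)
    (hx : x ∈ frontier Ω) : ‖outwardNormal Ω x‖ = 1 := by
  obtain ⟨U, ρ, hxU, h, he⟩ := hΩ.isOutwardUnitNormal hx
  rw [he, norm_smul, norm_inv, norm_norm,
    inv_mul_cancel₀ (norm_ne_zero_iff.2 (h.gradient_ne_zero x hxU))]

lemma IsDefiningFunctionOn.continuousOn_gradient (h : IsDefiningFunctionOn Ω U ρ) :
    ContinuousOn (gradient ρ) U := by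
  have := h.contDiffOn.continuousOn_fderiv_of_isOpen h.isOpen (by simp)
  exact (InnerProductSpace.toDual ℝ (Euc d)).symm.continuous.comp_continuousOn this

lemma IsBoundedSmoothDomain.continuousOn_outwardNormal (hΩ : IsBoundedSmoothDomain Ω) :
    ContinuousOn (outwardNormal Ω) (frontier Ω) := by
  intro x hx
  obtain ⟨U, ρ, hxU, h⟩ := hΩ.smooth_boundary x hx
  have hg : ContinuousAt (gradient ρ) x := h.continuousOn_gradient.continuousAt
    (h.isOpen.mem_nhds hxU)
  have hc : ContinuousAt (fun y => ‖gradient ρ y‖⁻¹ • gradient ρ y) x :=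
    (hg.norm.inv₀ (norm_ne_zero_iff.2 (h.gradient_ne_zero x hxU))).smul hg
  refine hc.continuousWithinAt.congr_of_eventuallyEq ?_ (h.outwardNormal_eq hΩ hxU hx)
  filter_upwards [self_mem_nhdsWithin, mem_nhdsWithin_of_mem_nhds (h.isOpen.mem_nhds hxU)]
    with y hy1 hy2
  exact h.outwardNormal_eq hΩ hy2 hy1

lemma IsBoundedSmoothDomain.isCompact_closure (hΩ : IsBoundedSmoothDomain Ω) :
    IsCompact (closure Ω) := hΩ.isBounded.isCompact_closure

lemma IsBoundedSmoothDomain.isCompact_frontier (hΩ : IsBoundedSmoothDomain Ω) :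
    IsCompact (frontier Ω) :=
  hΩ.isCompact_closure.of_isClosed_subset isClosed_frontier frontier_subset_closure

/-- Near a boundary point, the domain is a flat patch. -/
lemma IsBoundedSmoothDomain.exists_flatPatch (hΩ : IsBoundedSmoothDomain Ω)
    (hx : x ∈ frontier Ω) {η : ℝ} (hη : 0 < η) :
    ∃ ρ : Euc d → ℝ, ∃ r > 0, IsFlatPatch Ω ρ (outwardNormal Ω x) x r η ∧
      frontier Ω ∩ Metric.closedBall x r = zeroPatch ρ x r ∧
      ∀ y ∈ frontier Ω ∩ Metric.closedBall x r, ‖outwardNormal Ω y - outwardNormal Ω x‖ ≤ η := by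
  obtain ⟨U, ρ, hxU, h, he⟩ := hΩ.isOutwardUnitNormal hx
  have hg : 0 < ‖gradient ρ x‖ := norm_pos_iff.2 (h.gradient_ne_zero x hxU)
  have hs : HasStrictFDerivAt ρ (fderiv ℝ ρ x) x :=
    (h.contDiffAt hxU).hasStrictFDerivAt (by simp)
  -- Strict differentiability makes `ρ` minus its linearization Lipschitz with an arbitrarily small
  -- constant near `x`. The constant carries `‖gradient ρ x‖` because `ρ` is divided by it below, to
  -- give slope exactly the unit normal.
  obtain ⟨s, hs1, hs2⟩ := hs.approximates_deriv_on_nhds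
    (c := (⟨η * ‖gradient ρ x‖, by positivity⟩ : NNReal))
    (Or.inr (show 0 < η * ‖gradient ρ x‖ by positivity))
  have hc := Metric.continuousWithinAt_iff'.1 (hΩ.continuousOn_outwardNormal x hx) η hη
  rw [eventually_nhdsWithin_iff] at hc
  have hnhds : {y | y ∈ frontier Ω → dist (outwardNormal Ω y) (outwardNormal Ω x) < η} ∩ (s ∩ U)
      ∈ 𝓝 x := inter_mem hc (inter_mem hs1 (h.isOpen.mem_nhds hxU))
  obtain ⟨r, hr, hrs⟩ := Metric.nhds_basis_closedBall.mem_iff.1 hnhds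
  refine ⟨fun y => ‖gradient ρ x‖⁻¹ * ρ y, r, hr, ⟨?_, ?_⟩, ?_, ?_⟩
  · intro y hy y' hy'
    have := hs2 y (hrs hy).2.1 y' (hrs hy').2.1
    rw [he, real_inner_smul_left, inner_gradient, ← mul_sub, ← mul_sub, abs_mul, abs_inv,
      abs_norm, inv_mul_le_iff₀ hg]
    rw [Real.norm_eq_abs] at this
    refine this.trans (le_of_eq ?_)
    change η * ‖gradient ρ x‖ * _ = _
    ring
  · intro y hy
    rw [h.mem_iff y (hrs hy).2.2, mul_neg_iff]
    simp [hg, hg.le]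
  · ext y
    simp only [Set.mem_inter_iff, zeroPatch, Set.mem_ofPred_eq, mul_eq_zero, inv_eq_zero, hg.ne',
      false_or]
    exact ⟨fun hy => ⟨hy.2, h.eq_zero hΩ.isOpen (hrs hy.2).2.2 hy.1⟩,
      fun hy => ⟨h.mem_frontier hΩ.isOpen (hrs hy.1).2.2 hy.2, hy.1⟩⟩
  · intro y hy
    rw [← dist_eq_norm]
    exact ((hrs hy.2).1 hy.1).le

/-- The derivative of a function vanishing on the boundary is normal. -/
lemma IsBoundedSmoothDomain.fderiv_eq_of_frontier_eq_zero (hΩ : IsBoundedSmoothDomain Ω)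
    (hx : x ∈ frontier Ω) {p : Euc d → ℝ} (hp : ContDiff ℝ 1 p) (h0 : ∀ y ∈ frontier Ω, p y = 0)
    (w : Euc d) :
    fderiv ℝ p x w = ⟪outwardNormal Ω x, w⟫_ℝ * fderiv ℝ p x (outwardNormal Ω x) := by
  obtain ⟨U, ρ, hxU, h, he⟩ := hΩ.isOutwardUnitNormal hx
  have hρ0 : ρ x = 0 := h.eq_zero hΩ.isOpen hxU hx
  have hg : 0 < ‖gradient ρ x‖ := norm_pos_iff.2 (h.gradient_ne_zero x hxU)
  -- Near `x` the level set of `ρ` lies in the boundary, where `p` is zero, so `x` is trivially a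
  -- constrained extremum and Lagrange multipliers make the two differentials proportional.
  have hext : IsLocalExtrOn p {y | ρ y = ρ x} x := by
    refine Or.inl ?_
    change ∀ᶠ y in 𝓝[{y | ρ y = ρ x}] x, p x ≤ p y
    filter_upwards [self_mem_nhdsWithin, mem_nhdsWithin_of_mem_nhds (h.isOpen.mem_nhds hxU)]
      with y hy1 hy2
    rw [h0 x hx, h0 y (h.mem_frontier hΩ.isOpen hy2 (hy1.trans hρ0))]
  obtain ⟨a, b, hab, hlin⟩ := hext.exists_multipliers_of_hasStrictFDerivAt_1d
    ((h.contDiffAt hxU).hasStrictFDerivAt (by simp)) (hp.contDiffAt.hasStrictFDerivAt (by simp))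
  have hl : ∀ v, a * ⟪gradient ρ x, v⟫_ℝ + b * fderiv ℝ p x v = 0 := fun v => by
    rw [inner_gradient]
    simpa using DFunLike.congr_fun hlin v
  -- A zero multiplier of `dp` would force `∇ρ = 0`.
  have hb : b ≠ 0 := by
    rintro rfl
    have := hl (gradient ρ x)
    rw [zero_mul, add_zero, mul_eq_zero, real_inner_self_eq_norm_sq] at this
    rcases this with rfl | h2
    · exact hab rfl
    · exact absurd h2 (by positivity)
  have hν := hl (outwardNormal Ω x)
  have hw := hl w
  have h1 : ⟪gradient ρ x, outwardNormal Ω x⟫_ℝ = ‖gradient ρ x‖ := by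
    rw [he, real_inner_smul_right, real_inner_self_eq_norm_sq]
    field_simp
  have h2 : ⟪gradient ρ x, w⟫_ℝ = ‖gradient ρ x‖ * ⟪outwardNormal Ω x, w⟫_ℝ := by
    rw [he, real_inner_smul_left]
    field_simp
  rw [h1] at hν
  rw [h2] at hw
  apply mul_left_cancel₀ hb
  linear_combination hw - ⟪outwardNormal Ω x, w⟫_ℝ * hν

/-! ### The divergence theorem on smooth domains -/

open Filter Topology

lemma integrableOn_of_continuousOn_compact {α : Type*} [TopologicalSpace α] [T2Space α]
    [MeasurableSpace α] [BorelSpace α] [SecondCountableTopology α]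
    {μ : Measure α} {S : Set α} (hS : IsCompact S) (hμ : μ S < ⊤) {f : α → ℝ}
    (hf : ContinuousOn f S) : IntegrableOn f S μ := by
  obtain ⟨C, hC⟩ := hS.exists_bound_of_continuousOn hf
  have : IsFiniteMeasure (μ.restrict S) := ⟨by simpa using hμ⟩
  exact Integrable.of_bound (hf.aestronglyMeasurable hS.measurableSet) C
    ((ae_restrict_iff' hS.measurableSet).2 (ae_of_all _ hC))

/-- The factor 3 bounds the norm of the oblique directions used in `exists_ball_flux`. -/
lemma exists_almost_isometry_constant (k : ℕ) {κ : ℝ} (hκ : 0 < κ) :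
    ∃ η > 0, η ≤ κ ∧ 3 * η < 1 ∧ (1 + 3 * η) ^ k ≤ 1 + κ ∧ 1 - κ ≤ (1 - 3 * η) ^ k := by
  have h1 : ∀ᶠ η : ℝ in 𝓝 0, (1 + 3 * η) ^ k < 1 + κ := by
    have : Continuous fun η : ℝ => (1 + 3 * η) ^ k := by fun_prop
    exact (this.tendsto 0).eventually (eventually_lt_nhds (by simpa using hκ))
  have h2 : ∀ᶠ η : ℝ in 𝓝 0, 1 - κ < (1 - 3 * η) ^ k := by
    have : Continuous fun η : ℝ => (1 - 3 * η) ^ k := by fun_prop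
    exact (this.tendsto 0).eventually (eventually_gt_nhds (by simpa using hκ))
  have h3 : ∀ᶠ η : ℝ in 𝓝 0, η < κ := eventually_lt_nhds hκ
  have h4 : ∀ᶠ η : ℝ in 𝓝 0, η < 1 / 3 := eventually_lt_nhds (by norm_num)
  have h5 := ((h1.and h2).and (h3.and h4)).filter_mono (nhdsWithin_le_nhds (s := Set.Ioi 0))
  obtain ⟨η, ⟨⟨a, b⟩, c, e⟩, hη⟩ := (h5.and self_mem_nhdsWithin).exists
  exact ⟨η, hη, c.le, by linarith, a.le, b.le⟩

variable {d : ℕ} {Ω : Set (Euc d)} {x : Euc d}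

lemma finrank_orthogonal_singleton {n : Euc d} (hn : ‖n‖ = 1) :
    Module.finrank ℝ (ℝ ∙ n)ᗮ = d - 1 := by
  have h := (ℝ ∙ n).finrank_add_finrank_orthogonal
  rw [finrank_span_singleton (by rintro rfl; simp at hn), finrank_euclideanSpace,
    Fintype.card_fin] at h
  omega

/-- Each flat patch is a Lipschitz image of a compact subset of a hyperplane, and compactness passes
from local to global finiteness. -/
lemma IsBoundedSmoothDomain.measure_frontier_lt_top (hΩ : IsBoundedSmoothDomain Ω) :
    (μHE[d - 1] : Measure (Euc d)) (frontier Ω) < ⊤ := by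
  refine hΩ.isCompact_frontier.measure_lt_top_of_nhdsWithin fun x hx => ?_
  obtain ⟨ρ, r, hr, hP, hS, -⟩ := hΩ.exists_flatPatch hx (η := 1 / 2) (by norm_num)
  have hn := hΩ.norm_outwardNormal hx
  refine ⟨zeroPatch ρ x r, ?_, hP.measure_zeroPatch_lt_top (finrank_orthogonal_singleton hn)
    (e := outwardNormal Ω x) (by rw [real_inner_self_eq_norm_sq, hn]; norm_num) (by norm_num)
    (by rw [hn]; norm_num)⟩
  rw [← hS]
  exact inter_mem_nhdsWithin _ (Metric.closedBall_mem_nhds x hr)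

lemma IsBoundedSmoothDomain.integrableOn_frontier (hΩ : IsBoundedSmoothDomain Ω)
    {f : Euc d → ℝ} (hf : ContinuousOn f (frontier Ω)) :
    IntegrableOn f (frontier Ω) (μHE[d - 1]) :=
  integrableOn_of_continuousOn_compact hΩ.isCompact_frontier hΩ.measure_frontier_lt_top hf

lemma IsBoundedSmoothDomain.integrableOn (hΩ : IsBoundedSmoothDomain Ω)
    {f : Euc d → ℝ} (hf : Continuous f) : IntegrableOn f Ω :=
  (hf.continuousOn.integrableOn_compact hΩ.isCompact_closure).mono_set subset_closure

/-- The patch estimate applies to directions `e` with `⟪n, e⟫ = 1`. A general `w` is `e + (⟪n, w⟫ -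
1) n` with `e = n + w - ⟪n, w⟫ n`, so it suffices to use the directions `e` and `n`, both of norm at
most 3. -/
lemma IsBoundedSmoothDomain.exists_ball_flux (hΩ : IsBoundedSmoothDomain Ω)
    (hx : x ∈ frontier Ω) {κ : ℝ} (hκ : 0 < κ) (hκ1 : κ ≤ 1) :
    ∃ r > 0, ∀ w : Euc d, ‖w‖ ≤ 1 → ∀ f : Euc d → ℝ, ContDiff ℝ 1 f →
      tsupport f ⊆ Metric.closedBall x r →
      |(∫ y in Ω, fderiv ℝ f y w) - ∫ y in frontier Ω, f y * ⟪w, outwardNormal Ω y⟫_ℝ ∂μHE[d - 1]|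
        ≤ 4 * κ * ∫ y in frontier Ω, |f y| ∂μHE[d - 1] := by
  obtain ⟨η, hη, hηκ, hη3, hη4, hη5⟩ := exists_almost_isometry_constant (d - 1) hκ
  obtain ⟨ρ, r, hr, hP, hS, hν⟩ := hΩ.exists_flatPatch hx hη
  refine ⟨r, hr, fun w hw f hf hK => ?_⟩
  set n := outwardNormal Ω x with hn_def
  have hn : ‖n‖ = 1 := hΩ.norm_outwardNormal hx
  have hnn : ⟪n, n⟫_ℝ = 1 := by rw [real_inner_self_eq_norm_sq, hn]; norm_num
  have hfS : ∀ g : Euc d → ℝ, (∀ y, f y = 0 → g y = 0) →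
      ∫ y in frontier Ω, g y ∂μHE[d - 1] = ∫ y in zeroPatch ρ x r, g y ∂μHE[d - 1] := by
    intro g hg
    rw [← hS]
    refine setIntegral_eq_of_subset_of_forall_sdiff_eq_zero
      hΩ.isCompact_frontier.measurableSet Set.inter_subset_left fun y hy => hg y ?_
    exact image_eq_zero_of_notMem_tsupport fun h => hy.2 ⟨hy.1, hK h⟩
  have hSc : IsCompact (zeroPatch ρ x r) := hP.isCompact_zeroPatch hη.le
  have hSub : zeroPatch ρ x r ⊆ frontier Ω := hS ▸ Set.inter_subset_left
  have key : ∀ e : Euc d, ⟪n, e⟫_ℝ = 1 → ‖e‖ ≤ 3 →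
      |(∫ y in Ω, fderiv ℝ f y e) - ∫ y in zeroPatch ρ x r, f y ∂μHE[d - 1]| ≤
        κ * ∫ y in zeroPatch ρ x r, |f y| ∂μHE[d - 1] := by
    intro e he he3
    have hle : η * ‖e‖ ≤ 3 * η := by nlinarith
    have h0 : 0 ≤ η * ‖e‖ := by positivity
    refine hP.abs_integral_fderiv_sub_le (finrank_orthogonal_singleton hn)
      hΩ.isOpen.measurableSet hn he hη.le (by linarith) hκ.le hκ1 ?_ ?_ hf hK
    · refine le_trans ?_ hη4
      gcongr
    · refine hη5.trans ?_
      gcongr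
  have hnorm : |⟪n, w⟫_ℝ| ≤ 1 := by
    refine (abs_real_inner_le_norm n w).trans ?_
    rw [hn, one_mul]
    exact hw
  have k1 := key n hnn (by rw [hn]; norm_num)
  have k2 := key (n + w - ⟪n, w⟫_ℝ • n) (by
    rw [inner_sub_right, inner_add_right, real_inner_smul_right, hnn]; ring) (by
    refine (norm_sub_le _ _).trans ?_
    have h1 := norm_add_le n w
    rw [norm_smul, hn, Real.norm_eq_abs]
    linarith)
  have hdi : ∀ e : Euc d, IntegrableOn (fun y => fderiv ℝ f y e) Ω := fun e =>
    hΩ.integrableOn ((hf.continuous_fderiv one_ne_zero).clm_apply continuous_const)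
  have hlin : ∫ y in Ω, fderiv ℝ f y w =
      (∫ y in Ω, fderiv ℝ f y (n + w - ⟪n, w⟫_ℝ • n)) +
        (⟪n, w⟫_ℝ - 1) * ∫ y in Ω, fderiv ℝ f y n := by
    rw [← integral_const_mul, ← integral_add (hdi _) ((hdi n).const_mul _)]
    congr 1
    ext y
    simp only [map_sub, map_add, map_smul, smul_eq_mul]
    ring
  rw [hfS _ (fun y hy => by rw [hy, zero_mul]), hfS _ (fun y hy => by rw [hy, abs_zero])]
  have hfi : IntegrableOn f (zeroPatch ρ x r) (μHE[d - 1]) :=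
    (hΩ.integrableOn_frontier hf.continuous.continuousOn).mono_set hSub
  have hfw : IntegrableOn (fun y => f y * ⟪w, outwardNormal Ω y⟫_ℝ) (zeroPatch ρ x r)
      (μHE[d - 1]) :=
    (hΩ.integrableOn_frontier (hf.continuous.continuousOn.mul
      (continuousOn_const.inner hΩ.continuousOn_outwardNormal))).mono_set hSub
  -- Freezing the normal at the centre costs at most `η ≤ κ`, since the normal varies by at most `η`
  -- on the patch.
  have hdiff : |⟪n, w⟫_ℝ * (∫ y in zeroPatch ρ x r, f y ∂μHE[d - 1]) -
      ∫ y in zeroPatch ρ x r, f y * ⟪w, outwardNormal Ω y⟫_ℝ ∂μHE[d - 1]| ≤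
      κ * ∫ y in zeroPatch ρ x r, |f y| ∂μHE[d - 1] := by
    rw [← integral_const_mul, ← integral_const_mul, ← integral_sub (hfi.const_mul _) hfw,
      ← Real.norm_eq_abs]
    refine norm_integral_le_of_norm_le (hfi.abs.const_mul κ) ?_
    refine (ae_restrict_iff' hSc.measurableSet).2 (ae_of_all _ fun y hy => ?_)
    have h1 : ⟪n, w⟫_ℝ * f y - f y * ⟪w, outwardNormal Ω y⟫_ℝ
        = -(f y * ⟪w, outwardNormal Ω y - n⟫_ℝ) := by
      rw [inner_sub_right, real_inner_comm n w]; ring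
    rw [h1, norm_neg, norm_mul, Real.norm_eq_abs, Real.norm_eq_abs, mul_comm]
    gcongr
    refine (abs_real_inner_le_norm _ _).trans ?_
    have := hν y (hS ▸ hy)
    nlinarith [norm_nonneg w, norm_nonneg (outwardNormal Ω y - n)]
  set J := ∫ y in zeroPatch ρ x r, f y ∂μHE[d - 1]
  set N := ∫ y in zeroPatch ρ x r, |f y| ∂μHE[d - 1] with hN
  have hN0 : 0 ≤ N := integral_nonneg fun _ => abs_nonneg _
  rw [hlin]
  set I1 := ∫ y in Ω, fderiv ℝ f y (n + w - ⟪n, w⟫_ℝ • n)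
  set I2 := ∫ y in Ω, fderiv ℝ f y n
  set B := ∫ y in zeroPatch ρ x r, f y * ⟪w, outwardNormal Ω y⟫_ℝ ∂μHE[d - 1]
  set a := ⟪n, w⟫_ℝ
  have ha : |a - 1| ≤ 2 := by
    rw [abs_le] at hnorm ⊢
    constructor <;> linarith
  have h3 : |(a - 1) * (I2 - J)| ≤ 2 * (κ * N) := by
    rw [abs_mul]
    gcongr
  -- The three errors are at most `κN`, `2κN` and `κN`, whence the constant 4.
  have e1 : I1 + (a - 1) * I2 - B = (I1 - J) + (a - 1) * (I2 - J) + (a * J - B) := by ring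
  rw [e1]
  refine (abs_add_three _ _ _).trans ?_
  linarith

lemma IsBoundedSmoothDomain.exists_nhds_flux (hΩ : IsBoundedSmoothDomain Ω)
    (hx : x ∈ closure Ω) {κ : ℝ} (hκ : 0 < κ) (hκ1 : κ ≤ 1) :
    ∃ U : Set (Euc d), IsOpen U ∧ x ∈ U ∧ ∀ w : Euc d, ‖w‖ ≤ 1 → ∀ f : Euc d → ℝ,
      ContDiff ℝ 1 f → tsupport f ⊆ U →
      |(∫ y in Ω, fderiv ℝ f y w) - ∫ y in frontier Ω, f y * ⟪w, outwardNormal Ω y⟫_ℝ ∂μHE[d - 1]|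
        ≤ 4 * κ * ∫ y in frontier Ω, |f y| ∂μHE[d - 1] := by
  by_cases hxΩ : x ∈ Ω
  · refine ⟨Ω, hΩ.isOpen, hxΩ, fun w hw f hf hK => ?_⟩
    have hc : HasCompactSupport f := HasCompactSupport.of_support_subset_isCompact
      hΩ.isCompact_closure ((subset_tsupport f).trans (hK.trans subset_closure))
    have h1 : ∫ y in Ω, fderiv ℝ f y w = 0 := by
      rw [setIntegral_eq_integral_of_forall_compl_eq_zero fun y hy => by
        rw [image_eq_zero_of_notMem_tsupport fun h => hy (hK (tsupport_fderiv_subset ℝ h)),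
          zero_apply]]
      have hi : Integrable fun y => fderiv ℝ f y w :=
        ((hf.continuous_fderiv one_ne_zero).clm_apply
          continuous_const).integrable_of_hasCompactSupport (hc.fderiv_apply (𝕜 := ℝ) w)
      -- Integration by parts against the constant function 1.
      have := integral_mul_fderiv_eq_neg_fderiv_mul_of_integrable (μ := volume)
        (f := fun _ : Euc d => (1 : ℝ)) (g := f) (v := w) (by simp) (by simpa using hi)
        (by simpa using hf.continuous.integrable_of_hasCompactSupport hc)
        (fun _ _ => differentiableAt_const _) (fun y _ => hf.differentiable one_ne_zero y)
      simpa using this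
    have h2 : ∫ y in frontier Ω, f y * ⟪w, outwardNormal Ω y⟫_ℝ ∂μHE[d - 1] = 0 := by
      refine setIntegral_eq_zero_of_forall_eq_zero fun y hy => ?_
      rw [image_eq_zero_of_notMem_tsupport (f := f) fun h => ?_, zero_mul]
      rw [hΩ.isOpen.frontier_eq] at hy
      exact hy.2 (hK h)
    rw [h1, h2, sub_zero, abs_zero]
    exact mul_nonneg (by positivity) (integral_nonneg fun _ => abs_nonneg _)
  · have hxf : x ∈ frontier Ω := by rw [hΩ.isOpen.frontier_eq]; exact ⟨hx, hxΩ⟩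
    obtain ⟨r, hr, h⟩ := hΩ.exists_ball_flux hxf hκ hκ1
    exact ⟨Metric.ball x r, Metric.isOpen_ball, Metric.mem_ball_self hr, fun w hw f hf hK =>
      h w hw f hf (hK.trans Metric.ball_subset_closedBall)⟩

-- Compactness is used before partitioning so that the index set is finite and sums can be exchanged
-- with integrals freely.
open Manifold in
lemma exists_partition {K : Set (Euc d)} (hK : IsCompact K) (U : Euc d → Set (Euc d))
    (hU : ∀ x ∈ K, IsOpen (U x) ∧ x ∈ U x) :
    ∃ (t : Finset (Euc d)) (χ : t → Euc d → ℝ), (∀ i ∈ t, i ∈ K) ∧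
      (∀ i, ContDiff ℝ ∞ (χ i)) ∧ (∀ i y, 0 ≤ χ i y) ∧ (∀ i, tsupport (χ i) ⊆ U i) ∧
      ∀ y ∈ K, ∑ i, χ i y = 1 := by
  obtain ⟨t, ht, hcov⟩ := hK.elim_nhds_subcover U fun x hx => (hU x hx).1.mem_nhds (hU x hx).2
  obtain ⟨χ, hχ⟩ := SmoothPartitionOfUnity.exists_isSubordinate 𝓘(ℝ, Euc d) hK.isClosed
    (fun i : t => U i) (fun i => (hU i (ht i i.2)).1) (by simpa [Set.iUnion_subtype] using hcov)
  refine ⟨t, fun i => χ i, ht, fun i => (χ i).contMDiff.contDiff,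
    fun i y => χ.nonneg i y, fun i => hχ i, fun y hy => ?_⟩
  rw [← finsum_eq_sum_of_fintype]
  exact χ.sum_eq_one hy

/-- The divergence theorem: the integral of a directional derivative over `Ω` is the flux through
the boundary, with respect to the `(d-1)`-dimensional Hausdorff measure. -/
theorem IsBoundedSmoothDomain.integral_fderiv (hΩ : IsBoundedSmoothDomain Ω) {w : Euc d}
    (hw : ‖w‖ ≤ 1) {f : Euc d → ℝ} (hf : ContDiff ℝ 1 f) :
    ∫ y in Ω, fderiv ℝ f y w =
      ∫ y in frontier Ω, f y * ⟪w, outwardNormal Ω y⟫_ℝ ∂μHE[d - 1] := by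
  set N := ∫ y in frontier Ω, |f y| ∂μHE[d - 1] with hN
  have hN0 : 0 ≤ N := integral_nonneg fun _ => abs_nonneg _
  have main : ∀ κ : ℝ, 0 < κ → κ ≤ 1 → |(∫ y in Ω, fderiv ℝ f y w) -
      ∫ y in frontier Ω, f y * ⟪w, outwardNormal Ω y⟫_ℝ ∂μHE[d - 1]| ≤ 4 * κ * N := by
    intro κ hκ hκ1
    choose! U hUo hxU hU using fun x (hx : x ∈ closure Ω) => hΩ.exists_nhds_flux hx hκ hκ1
    obtain ⟨t, χ, htK, hχs, hχ0, hχU, hχ1⟩ := exists_partition hΩ.isCompact_closure U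
      fun x hx => ⟨hUo x hx, hxU x hx⟩
    have hχf : ∀ i, ContDiff ℝ 1 fun y => χ i y * f y := fun i =>
      ((hχs i).of_le (by simp)).mul hf
    have hsup : ∀ i, tsupport (fun y => χ i y * f y) ⊆ U i := fun i =>
      (tsupport_mul_subset_left).trans (hχU i)
    have hi := fun i : t => hU i (htK i i.2) w hw _ (hχf i) (hsup i)
    have hΩsum : ∫ y in Ω, fderiv ℝ f y w =
        ∑ i, ∫ y in Ω, fderiv ℝ (fun y => χ i y * f y) y w := by
      rw [← integral_finsetSum _ fun i _ => hΩ.integrableOn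
        (((hχf i).continuous_fderiv one_ne_zero).clm_apply continuous_const)]
      refine setIntegral_congr_fun hΩ.isOpen.measurableSet fun y hy => ?_
      -- The cutoffs sum to 1 only on `closure Ω`, but `Ω` is open, so the identity holds near `y`
      -- and can be differentiated.
      have hev : f =ᶠ[𝓝 y] fun y => ∑ i, χ i y * f y := by
        filter_upwards [hΩ.isOpen.mem_nhds hy] with y' hy'
        rw [← Finset.sum_mul, hχ1 y' (subset_closure hy'), one_mul]
      rw [hev.fderiv_eq, fderiv_fun_sum fun i _ => (hχf i).differentiable one_ne_zero y,
        sum_apply]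
    have hfr : frontier Ω ⊆ closure Ω := frontier_subset_closure
    have hfsum : ∫ y in frontier Ω, f y * ⟪w, outwardNormal Ω y⟫_ℝ ∂μHE[d - 1] =
        ∑ i, ∫ y in frontier Ω, (χ i y * f y) * ⟪w, outwardNormal Ω y⟫_ℝ ∂μHE[d - 1] := by
      have hint : ∀ i, IntegrableOn (fun y => (χ i y * f y) * ⟪w, outwardNormal Ω y⟫_ℝ)
          (frontier Ω) (μHE[d - 1]) := fun i => hΩ.integrableOn_frontier
        ((hχf i).continuous.continuousOn.mul
          (continuousOn_const.inner hΩ.continuousOn_outwardNormal))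
      rw [← integral_finsetSum _ fun i _ => hint i]
      refine setIntegral_congr_fun hΩ.isCompact_frontier.measurableSet fun y hy => ?_
      rw [← Finset.sum_mul, ← Finset.sum_mul, hχ1 y (hfr hy), one_mul]
    -- Since the cutoffs are nonnegative, the local errors add up to a multiple of `N` that does not
    -- grow with the number of patches, which itself depends on `κ`.
    have hNsum : N = ∑ i, ∫ y in frontier Ω, |χ i y * f y| ∂μHE[d - 1] := by
      rw [← integral_finsetSum _ fun i _ => hΩ.integrableOn_frontier
        (hχf i).continuous.abs.continuousOn, hN]
      refine setIntegral_congr_fun hΩ.isCompact_frontier.measurableSet fun y hy => ?_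
      simp only [abs_mul, abs_of_nonneg (hχ0 _ _)]
      rw [← Finset.sum_mul, hχ1 y (hfr hy), one_mul]
    rw [hΩsum, hfsum, hNsum, ← Finset.sum_sub_distrib, Finset.mul_sum]
    exact (Finset.abs_sum_le_sum_abs _ _).trans (Finset.sum_le_sum fun i _ => hi i)
  by_contra hne
  set A := |(∫ y in Ω, fderiv ℝ f y w) -
      ∫ y in frontier Ω, f y * ⟪w, outwardNormal Ω y⟫_ℝ ∂μHE[d - 1]| with hA
  have hApos : 0 < A := abs_pos.2 (sub_ne_zero.2 hne)
  -- With this `κ` the bound `4κN` is at most `A / 2`, a contradiction; `N + 1` avoids division by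
  -- zero.
  have h1 := main (min 1 (A / (8 * (N + 1)))) (by positivity) (min_le_left _ _)
  have h2 : min 1 (A / (8 * (N + 1))) * N ≤ A / (8 * (N + 1)) * (N + 1) := by
    gcongr
    · exact min_le_right _ _
    · linarith
  have h3 : A / (8 * (N + 1)) * (N + 1) = A / 8 := by field_simp
  linarith

/-- The divergence theorem for a vector field. -/
theorem IsBoundedSmoothDomain.integral_divergence (hΩ : IsBoundedSmoothDomain Ω)
    {F : Fin d → Euc d → ℝ} (hF : ∀ j, ContDiff ℝ 1 (F j)) :
    ∫ y in Ω, ∑ j, fderiv ℝ (F j) y (EuclideanSpace.single j 1) =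
      ∫ y in frontier Ω, ∑ j, F j y * outwardNormal Ω y j ∂μHE[d - 1] := by
  have hint : ∀ j, IntegrableOn (fun y => F j y * outwardNormal Ω y j) (frontier Ω)
      (μHE[d - 1]) := fun j => hΩ.integrableOn_frontier
    ((hF j).continuous.continuousOn.mul ((EuclideanSpace.proj (𝕜 := ℝ)
      j).continuous.comp_continuousOn hΩ.continuousOn_outwardNormal))
  rw [integral_finsetSum _ fun j _ => hΩ.integrableOn
      (((hF j).continuous_fderiv one_ne_zero).clm_apply continuous_const),
    integral_finsetSum _ fun j _ => hint j]
  refine Finset.sum_congr rfl fun j _ => ?_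
  rw [hΩ.integral_fderiv (by simp) (hF j)]
  simp [EuclideanSpace.inner_single_left]

/-! ### Partial derivatives -/

section Partial

variable {d : ℕ} {F : Type*} [NormedAddCommGroup F] [NormedSpace ℝ F]

/-- The partial derivative `∂_j f`. -/
def pd (j : Fin d) (f : Euc d → F) (x : Euc d) : F := fderiv ℝ f x (EuclideanSpace.single j 1)

lemma contDiff_pd {f : Euc d → F} (hf : ContDiff ℝ ∞ f) (j : Fin d) : ContDiff ℝ ∞ (pd j f) :=
  (hf.fderiv_right (m := ∞) (by simp)).clm_apply contDiff_const

lemma differentiableAt_of_contDiff_top {f : Euc d → F} (hf : ContDiff ℝ ∞ f) (x : Euc d) :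
    DifferentiableAt ℝ f x := hf.differentiable (by simp) x

lemma fderiv_eq_sum_pd (f : Euc d → F) (x w : Euc d) :
    fderiv ℝ f x w = ∑ j, w j • pd j f x := by
  have h : w = ∑ j, w j • EuclideanSpace.single j (1 : ℝ) := by
    ext i
    simp [Finset.sum_apply, Pi.single_apply]
  conv_lhs => rw [h]
  simp [pd]

lemma pd_add {f g : Euc d → F} (hf : ContDiff ℝ ∞ f) (hg : ContDiff ℝ ∞ g) (j : Fin d)
    (x : Euc d) : pd j (fun y => f y + g y) x = pd j f x + pd j g x := by
  simp [pd, fderiv_fun_add (differentiableAt_of_contDiff_top hf x)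
    (differentiableAt_of_contDiff_top hg x)]

lemma pd_sub {f g : Euc d → F} (hf : ContDiff ℝ ∞ f) (hg : ContDiff ℝ ∞ g) (j : Fin d)
    (x : Euc d) : pd j (fun y => f y - g y) x = pd j f x - pd j g x := by
  simp [pd, fderiv_fun_sub (differentiableAt_of_contDiff_top hf x)
    (differentiableAt_of_contDiff_top hg x)]

lemma pd_const (c : F) (j : Fin d) (x : Euc d) : pd j (fun _ => c) x = 0 := by
  simp [pd]

lemma pd_sum {ι : Type*} {s : Finset ι} {f : ι → Euc d → F} (hf : ∀ i ∈ s, ContDiff ℝ ∞ (f i))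
    (j : Fin d) (x : Euc d) : pd j (fun y => ∑ i ∈ s, f i y) x = ∑ i ∈ s, pd j (f i) x := by
  simp [pd, fderiv_fun_sum fun i hi => differentiableAt_of_contDiff_top (hf i hi) x]

lemma pd_smul {f : Euc d → ℝ} {g : Euc d → F} (hf : ContDiff ℝ ∞ f) (hg : ContDiff ℝ ∞ g)
    (j : Fin d) (x : Euc d) :
    pd j (fun y => f y • g y) x = pd j f x • g x + f x • pd j g x := by
  simp [pd, fderiv_fun_smul (differentiableAt_of_contDiff_top hf x)
    (differentiableAt_of_contDiff_top hg x), add_comm]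

lemma pd_mul {f g : Euc d → ℝ} (hf : ContDiff ℝ ∞ f) (hg : ContDiff ℝ ∞ g)
    (j : Fin d) (x : Euc d) :
    pd j (fun y => f y * g y) x = pd j f x * g x + f x * pd j g x :=
  pd_smul hf hg j x

lemma pd_const_mul (c : ℝ) {f : Euc d → ℝ} (hf : ContDiff ℝ ∞ f) (j : Fin d) (x : Euc d) :
    pd j (fun y => c * f y) x = c * pd j f x := by
  simp [pd, fderiv_const_mul (differentiableAt_of_contDiff_top hf x)]

lemma pd_comm {f : Euc d → F} (hf : ContDiff ℝ ∞ f) (j k : Fin d) (x : Euc d) :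
    pd j (pd k f) x = pd k (pd j f) x := by
  have h2 : ∀ v w : Euc d, fderiv ℝ (fun y => fderiv ℝ f y v) x w
      = fderiv ℝ (fderiv ℝ f) x w v := by
    intro v w
    rw [fderiv_clm_apply ((hf.fderiv_right (m := ∞) (by simp)).differentiable (by simp) x)
      (differentiableAt_const v)]
    simp
  have hs : IsSymmSndFDerivAt ℝ f x :=
    (contDiff_infty.1 hf 2).contDiffAt.isSymmSndFDerivAt (by simp)
  unfold pd
  rw [h2, h2]
  exact hs _ _

end Partial

/-! ### The Rellich identity -/

section Rellich

variable {d : ℕ}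

/-- The vector field whose flux is the boundary term of the commutator identity. -/
def commFlux (h : ℝ) (Y : Fin d → Euc d → ℝ) (V p : Euc d → ℝ) (j : Fin d) (x : Euc d) : ℝ :=
  -2 * h ^ 3 * (∑ k, Y k x * (pd j p x * pd k p x))
    + h ^ 3 * (Y j x * ∑ k, pd k p x * pd k p x)
    - h ^ 3 * (pd j p x * ((∑ k, pd k (Y k) x) * p x))
    + h ^ 3 / 2 * ((p x * p x) * pd j (fun y => ∑ k, pd k (Y k) y) x)
    - h * ((V x * Y j x) * (p x * p x))

/-- The real symmetric part `-h²Δ - V`. -/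
def symPart (h : ℝ) (V p : Euc d → ℝ) (x : Euc d) : ℝ :=
  -h ^ 2 * (∑ j, pd j (pd j p) x) - V x * p x

/-- The real antisymmetric part `h (Y · ∇ + ½ div Y)`. -/
def skewPart (h : ℝ) (Y : Fin d → Euc d → ℝ) (p : Euc d → ℝ) (x : Euc d) : ℝ :=
  h * ((∑ k, Y k x * pd k p x) + 1 / 2 * (∑ k, pd k (Y k) x) * p x)

variable {Y : Fin d → Euc d → ℝ} {V p : Euc d → ℝ}

lemma contDiff_div (hY : ∀ k, ContDiff ℝ ∞ (Y k)) :
    ContDiff ℝ ∞ fun y => ∑ k, pd k (Y k) y :=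
  ContDiff.sum fun k _ => contDiff_pd (hY k) k

lemma contDiff_commFlux (hY : ∀ k, ContDiff ℝ ∞ (Y k)) (hV : ContDiff ℝ ∞ V)
    (hp : ContDiff ℝ ∞ p) (h : ℝ) (j : Fin d) : ContDiff ℝ ∞ (commFlux h Y V p j) := by
  have hpd := fun k => contDiff_pd hp k
  have hG := contDiff_div hY
  have hGd := contDiff_pd hG j
  unfold commFlux
  have h1 : ContDiff ℝ ∞ fun x => ∑ k, Y k x * (pd j p x * pd k p x) :=
    ContDiff.sum fun k _ => (hY k).mul ((hpd j).mul (hpd k))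
  have h2 : ContDiff ℝ ∞ fun x => ∑ k, pd k p x * pd k p x :=
    ContDiff.sum fun k _ => (hpd k).mul (hpd k)
  exact ((((contDiff_const.mul h1).add (contDiff_const.mul ((hY j).mul h2))).sub
    (contDiff_const.mul ((hpd j).mul (hG.mul hp)))).add
    (contDiff_const.mul ((hp.mul hp).mul hGd))).sub
    (contDiff_const.mul ((hV.mul (hY j)).mul (hp.mul hp)))

lemma pd_commFlux (hY : ∀ k, ContDiff ℝ ∞ (Y k)) (hV : ContDiff ℝ ∞ V)
    (hp : ContDiff ℝ ∞ p) (h : ℝ) (j : Fin d) (x : Euc d) :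
    pd j (commFlux h Y V p j) x =
      -2 * h ^ 3 * (∑ k, (pd j (Y k) x * (pd j p x * pd k p x) +
        Y k x * (pd j (pd j p) x * pd k p x + pd j p x * pd j (pd k p) x)))
      + h ^ 3 * (pd j (Y j) x * (∑ k, pd k p x * pd k p x) +
        Y j x * ∑ k, (pd j (pd k p) x * pd k p x + pd k p x * pd j (pd k p) x))
      - h ^ 3 * (pd j (pd j p) x * ((∑ k, pd k (Y k) x) * p x) +
        pd j p x * (pd j (fun y => ∑ k, pd k (Y k) y) x * p x + (∑ k, pd k (Y k) x) * pd j p x))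
      + h ^ 3 / 2 * ((pd j p x * p x + p x * pd j p x) * pd j (fun y => ∑ k, pd k (Y k) y) x +
        (p x * p x) * pd j (pd j (fun y => ∑ k, pd k (Y k) y)) x)
      - h * ((pd j V x * Y j x + V x * pd j (Y j) x) * (p x * p x) +
        (V x * Y j x) * (pd j p x * p x + p x * pd j p x)) := by
  have hpd := fun k => contDiff_pd hp k
  have hG := contDiff_div hY
  have hGd := contDiff_pd hG j
  have ha : ∀ k, ContDiff ℝ ∞ fun x => Y k x * (pd j p x * pd k p x) := fun k =>
    (hY k).mul ((hpd j).mul (hpd k))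
  have h1 : ContDiff ℝ ∞ fun x => ∑ k, Y k x * (pd j p x * pd k p x) :=
    ContDiff.sum fun k _ => ha k
  have hb : ∀ k, ContDiff ℝ ∞ fun x => pd k p x * pd k p x := fun k => (hpd k).mul (hpd k)
  have h2 : ContDiff ℝ ∞ fun x => ∑ k, pd k p x * pd k p x := ContDiff.sum fun k _ => hb k
  have h3 := (hY j).mul h2
  have h4 := (hpd j).mul (hG.mul hp)
  have h5 := (hp.mul hp).mul hGd
  have h6 := (hV.mul (hY j)).mul (hp.mul hp)
  unfold commFlux
  rw [pd_sub ((((contDiff_const.mul h1).add (contDiff_const.mul h3)).sub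
    (contDiff_const.mul h4)).add (contDiff_const.mul h5)) (contDiff_const.mul h6),
    pd_add (((contDiff_const.mul h1).add (contDiff_const.mul h3)).sub
    (contDiff_const.mul h4)) (contDiff_const.mul h5),
    pd_sub ((contDiff_const.mul h1).add (contDiff_const.mul h3)) (contDiff_const.mul h4),
    pd_add (contDiff_const.mul h1) (contDiff_const.mul h3),
    pd_const_mul _ h1, pd_const_mul _ h3, pd_const_mul _ h4, pd_const_mul _ h5, pd_const_mul _ h6,
    pd_sum fun k _ => ha k, pd_mul (hY j) h2, pd_sum fun k _ => hb k,
    pd_mul (hpd j) (hG.mul hp), pd_mul hG hp, pd_mul (hp.mul hp) hGd, pd_mul hp hp,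
    pd_mul (hV.mul (hY j)) (hp.mul hp), pd_mul hV (hY j), pd_mul hp hp]
  simp_rw [fun k => pd_mul (hY k) ((hpd j).mul (hpd k)) j x,
    fun k => pd_mul (hpd j) (hpd k) j x, fun k => pd_mul (hpd k) (hpd k) j x]

/-- The divergence computation at a fixed point, with all derivatives replaced by free numbers.
Besides `G = div Y` it needs only the symmetry of the second derivatives of `p`. -/
lemma comm_algebra (h G P v : ℝ) (Y p G1 G2 V1 : Fin d → ℝ) (Y1 p2 : Fin d → Fin d → ℝ)
    (hG : G = ∑ k, Y1 k k) (hp2 : ∀ j k, p2 j k = p2 k j) :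
    ∑ j, (-2 * h ^ 3 * (∑ k, (Y1 j k * (p j * p k) + Y k * (p2 j j * p k + p j * p2 j k)))
      + h ^ 3 * (Y1 j j * (∑ k, p k * p k) + Y j * ∑ k, (p2 j k * p k + p k * p2 j k))
      - h ^ 3 * (p2 j j * (G * P) + p j * (G1 j * P + G * p j))
      + h ^ 3 / 2 * ((p j * P + P * p j) * G1 j + (P * P) * G2 j)
      - h * ((V1 j * Y j + v * Y1 j j) * (P * P) + (v * Y j) * (p j * P + P * p j))) =
    2 * ((-h ^ 2 * (∑ j, p2 j j) - v * P) * (h * ((∑ k, Y k * p k) + 1 / 2 * G * P)))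
      - 2 * h ^ 3 * (∑ j, ∑ k, Y1 j k * (p j * p k)) - h * (∑ k, V1 k * Y k) * P ^ 2
      + h ^ 3 / 2 * P ^ 2 * ∑ j, G2 j := by
  have e1 : ∑ j, ∑ k, Y k * (p2 j j * p k) = (∑ j, p2 j j) * ∑ k, Y k * p k := by
    rw [Finset.sum_mul_sum]
    exact Finset.sum_congr rfl fun j _ => Finset.sum_congr rfl fun k _ => by ring
  have e2 : ∑ j, ∑ k, Y k * (p j * p2 j k) = ∑ j, Y j * ∑ k, p k * p2 j k := by
    rw [Finset.sum_comm]
    refine Finset.sum_congr rfl fun j _ => ?_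
    rw [Finset.mul_sum]
    exact Finset.sum_congr rfl fun k _ => by rw [hp2 k j]
  have e3 : ∀ j, ∑ k, (Y1 j k * (p j * p k) + Y k * (p2 j j * p k + p j * p2 j k)) =
      (∑ k, Y1 j k * (p j * p k)) + (∑ k, Y k * (p2 j j * p k)) + ∑ k, Y k * (p j * p2 j k) := by
    intro j
    rw [← Finset.sum_add_distrib, ← Finset.sum_add_distrib]
    exact Finset.sum_congr rfl fun k _ => by ring
  have e4 : ∀ j, ∑ k, (p2 j k * p k + p k * p2 j k) = 2 * ∑ k, p k * p2 j k := by
    intro j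
    rw [Finset.mul_sum]
    exact Finset.sum_congr rfl fun k _ => by ring
  calc _ = ∑ j, ((-2 * h ^ 3) * (∑ k, Y1 j k * (p j * p k))
        + (-2 * h ^ 3) * (∑ k, Y k * (p2 j j * p k))
        + (-2 * h ^ 3) * (∑ k, Y k * (p j * p2 j k))
        + (h ^ 3 * (∑ k, p k * p k)) * Y1 j j + (2 * h ^ 3) * (Y j * ∑ k, p k * p2 j k)
        + (-h ^ 3 * G * P) * p2 j j + (-h ^ 3 * G) * (p j * p j)
        + (h ^ 3 / 2 * P ^ 2) * G2 j + (-h * P ^ 2) * (V1 j * Y j) + (-h * v * P ^ 2) * Y1 j j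
        + (-2 * h * v * P) * (Y j * p j)) := by
        refine Finset.sum_congr rfl fun j _ => ?_
        rw [e3, e4]
        ring
    _ = _ := by
        simp only [Finset.sum_add_distrib, ← Finset.mul_sum]
        rw [e1, e2, ← hG]
        ring

/-- The first two terms of the flux are the Rellich–Pohozaev field for the multiplier `Y·∇p`; the
next two integrate `p (div Y) Δp` by parts, and the last handles the potential. -/
lemma divergence_commFlux (hY : ∀ k, ContDiff ℝ ∞ (Y k)) (hV : ContDiff ℝ ∞ V)
    (hp : ContDiff ℝ ∞ p) (h : ℝ) (x : Euc d) :
    ∑ j, pd j (commFlux h Y V p j) x =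
      2 * (symPart h V p x * skewPart h Y p x)
      - 2 * h ^ 3 * (∑ j, ∑ k, pd j (Y k) x * (pd j p x * pd k p x))
      - h * (∑ k, pd k V x * Y k x) * p x ^ 2
      + h ^ 3 / 2 * p x ^ 2 * ∑ j, pd j (pd j (fun y => ∑ k, pd k (Y k) y)) x := by
  simp_rw [pd_commFlux hY hV hp]
  exact comm_algebra h _ (p x) (V x) (fun k => Y k x) (fun k => pd k p x)
    (fun j => pd j (fun y => ∑ k, pd k (Y k) y) x)
    (fun j => pd j (pd j (fun y => ∑ k, pd k (Y k) y)) x) (fun k => pd k V x)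
    (fun j k => pd j (Y k) x) (fun j k => pd j (pd k p) x) rfl fun j k => pd_comm hp j k x

lemma contDiff_symPart (hV : ContDiff ℝ ∞ V) (hp : ContDiff ℝ ∞ p) (h : ℝ) :
    ContDiff ℝ ∞ (symPart h V p) :=
  (contDiff_const.mul (ContDiff.sum fun j _ => contDiff_pd (contDiff_pd hp j) j)).sub (hV.mul hp)

lemma contDiff_skewPart (hY : ∀ k, ContDiff ℝ ∞ (Y k)) (hp : ContDiff ℝ ∞ p) (h : ℝ) :
    ContDiff ℝ ∞ (skewPart h Y p) :=
  contDiff_const.mul ((ContDiff.sum fun k _ => (hY k).mul (contDiff_pd hp k)).add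
    ((contDiff_const.mul (contDiff_div hY)).mul hp))

variable {Ω : Set (Euc d)}

lemma IsBoundedSmoothDomain.pd_eq (hΩ : IsBoundedSmoothDomain Ω) (hp : ContDiff ℝ ∞ p)
    (h0 : ∀ y ∈ frontier Ω, p y = 0) {x : Euc d} (hx : x ∈ frontier Ω) (j : Fin d) :
    pd j p x = outwardNormal Ω x j * fderiv ℝ p x (outwardNormal Ω x) := by
  rw [pd, hΩ.fderiv_eq_of_frontier_eq_zero hx (hp.of_le (by simp)) h0]
  simp [EuclideanSpace.inner_single_right]

lemma sum_sq_eq_norm_sq (v : Euc d) : ∑ j, v j * v j = ‖v‖ ^ 2 := by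
  rw [EuclideanSpace.norm_sq_eq]
  exact Finset.sum_congr rfl fun j _ => by rw [Real.norm_eq_abs, sq_abs, sq]

/-- Where `p` vanishes, `∇p = (∂_ν p) ν`; only the two terms quadratic in `∇p` survive, with
coefficients `-2` and `+1`. -/
lemma IsBoundedSmoothDomain.commFlux_normal (hΩ : IsBoundedSmoothDomain Ω) (hp : ContDiff ℝ ∞ p)
    (h0 : ∀ y ∈ frontier Ω, p y = 0) {x : Euc d} (hx : x ∈ frontier Ω) (h : ℝ) :
    ∑ j, commFlux h Y V p j x * outwardNormal Ω x j =
      -h ^ 3 * ((∑ j, Y j x * outwardNormal Ω x j) *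
        fderiv ℝ p x (outwardNormal Ω x) ^ 2) := by
  set ν := outwardNormal Ω x with hν
  set a := fderiv ℝ p x ν with ha
  have hnn : ∑ j, ν j * ν j = 1 := by
    rw [sum_sq_eq_norm_sq, hν, hΩ.norm_outwardNormal hx, one_pow]
  have hpd : ∀ k, pd k p x = ν k * a := hΩ.pd_eq hp h0 hx
  have e1 : ∀ j, ∑ k, Y k x * (ν j * a * (ν k * a)) = a ^ 2 * ν j * ∑ k, Y k x * ν k := by
    intro j
    rw [Finset.mul_sum]
    exact Finset.sum_congr rfl fun k _ => by ring
  have e2 : ∑ k, ν k * a * (ν k * a) = a ^ 2 := by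
    rw [← mul_one (a ^ 2), ← hnn, Finset.mul_sum]
    exact Finset.sum_congr rfl fun k _ => by ring
  have e3 : ∀ j, commFlux h Y V p j x * ν j =
      (-2 * h ^ 3 * a ^ 2 * ∑ k, Y k x * ν k) * (ν j * ν j) + h ^ 3 * a ^ 2 * (Y j x * ν j) := by
    intro j
    rw [commFlux, h0 x hx]
    simp_rw [hpd]
    rw [e1, e2]
    ring
  simp_rw [e3]
  rw [Finset.sum_add_distrib, ← Finset.mul_sum, ← Finset.mul_sum, hnn]
  ring

/-- The commutator identity for a real function vanishing on the boundary. -/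
lemma IsBoundedSmoothDomain.integral_symPart_mul_skewPart (hΩ : IsBoundedSmoothDomain Ω)
    (hY : ∀ k, ContDiff ℝ ∞ (Y k)) (hV : ContDiff ℝ ∞ V) (hp : ContDiff ℝ ∞ p)
    (h0 : ∀ y ∈ frontier Ω, p y = 0) (h : ℝ) :
    ∫ x in Ω, 2 * (symPart h V p x * skewPart h Y p x) =
      (∫ x in Ω, (2 * h ^ 3 * (∑ j, ∑ k, pd j (Y k) x * (pd j p x * pd k p x))
        + h * (∑ k, pd k V x * Y k x) * p x ^ 2
        - h ^ 3 / 2 * p x ^ 2 * ∑ j, pd j (pd j (fun y => ∑ k, pd k (Y k) y)) x)) -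
      h ^ 3 * ∫ x in frontier Ω, (∑ j, Y j x * outwardNormal Ω x j) *
        fderiv ℝ p x (outwardNormal Ω x) ^ 2 ∂μHE[d - 1] := by
  have hF := fun j => contDiff_commFlux hY hV hp h j
  have hdiv := hΩ.integral_divergence (F := commFlux h Y V p) fun j => (hF j).of_le (by simp)
  have hb : ∫ y in frontier Ω, ∑ j, commFlux h Y V p j y * outwardNormal Ω y j ∂μHE[d - 1] =
      -h ^ 3 * ∫ x in frontier Ω, (∑ j, Y j x * outwardNormal Ω x j) *
        fderiv ℝ p x (outwardNormal Ω x) ^ 2 ∂μHE[d - 1] := by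
    rw [← integral_const_mul]
    exact setIntegral_congr_fun hΩ.isCompact_frontier.measurableSet fun x hx =>
      hΩ.commFlux_normal hp h0 hx h
  have hi1 : IntegrableOn (fun x => ∑ j, pd j (commFlux h Y V p j) x) Ω :=
    hΩ.integrableOn (ContDiff.sum fun j _ => contDiff_pd (hF j) j : ContDiff ℝ ∞ _).continuous
  have hi2 : IntegrableOn (fun x => 2 * (symPart h V p x * skewPart h Y p x)) Ω :=
    hΩ.integrableOn
      (contDiff_const.mul ((contDiff_symPart hV hp h).mul (contDiff_skewPart hY hp h))).continuous
  have hsub : (fun x => 2 * h ^ 3 * (∑ j, ∑ k, pd j (Y k) x * (pd j p x * pd k p x))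
        + h * (∑ k, pd k V x * Y k x) * p x ^ 2
        - h ^ 3 / 2 * p x ^ 2 * ∑ j, pd j (pd j (fun y => ∑ k, pd k (Y k) y)) x) =
      fun x => 2 * (symPart h V p x * skewPart h Y p x) -
        ∑ j, pd j (commFlux h Y V p j) x := by
    ext x
    rw [divergence_commFlux hY hV hp]
    ring
  rw [hsub, integral_sub hi2 hi1]
  change ∫ y in Ω, ∑ j, pd j (commFlux h Y V p j) y = _ at hdiv
  rw [hdiv, hb]
  ring

/-- Green's identity for two functions vanishing on the boundary. -/
lemma IsBoundedSmoothDomain.integral_green (hΩ : IsBoundedSmoothDomain Ω) {q : Euc d → ℝ}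
    (hp : ContDiff ℝ ∞ p) (hq : ContDiff ℝ ∞ q)
    (hp0 : ∀ y ∈ frontier Ω, p y = 0) (hq0 : ∀ y ∈ frontier Ω, q y = 0) (h : ℝ) :
    ∫ x in Ω, (q x * symPart h V p x - p x * symPart h V q x) = 0 := by
  have hs : ∀ j, ContDiff ℝ ∞ fun x => q x * pd j p x - p x * pd j q x := fun j =>
    (hq.mul (contDiff_pd hp j)).sub (hp.mul (contDiff_pd hq j))
  have hdiv := hΩ.integral_divergence (F := fun j x => q x * pd j p x - p x * pd j q x)
    fun j => (hs j).of_le (by simp)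
  have hz : ∫ y in frontier Ω, ∑ j, (q y * pd j p y - p y * pd j q y) * outwardNormal Ω y j
      ∂μHE[d - 1] = 0 := by
    refine setIntegral_eq_zero_of_forall_eq_zero fun y hy => ?_
    simp [hp0 y hy, hq0 y hy]
  rw [hz] at hdiv
  rw [← mul_zero (-h ^ 2), ← hdiv, ← integral_const_mul]
  congr 1
  ext x
  have e : ∀ j, fderiv ℝ (fun x => q x * pd j p x - p x * pd j q x) x
      (EuclideanSpace.single j 1) = q x * pd j (pd j p) x - p x * pd j (pd j q) x := by
    intro j
    change pd j (fun x => q x * pd j p x - p x * pd j q x) x = _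
    rw [pd_sub (hq.mul (contDiff_pd hp j)) (hp.mul (contDiff_pd hq j)),
      pd_mul hq (contDiff_pd hp j), pd_mul hp (contDiff_pd hq j)]
    ring
  simp_rw [e, Finset.sum_sub_distrib, ← Finset.mul_sum]
  unfold symPart
  ring

end Rellich

/-! ### Conjugation by the weight -/

section Conjugation

variable {d : ℕ}

/-- The vector field `2ε∂ψ + X`. -/
def weightField (X : Euc d) (ψ : Euc d → ℝ) (ε : ℝ) (k : Fin d) (x : Euc d) : ℝ :=
  2 * ε * pd k ψ x + X k

/-- The potential `|ε∂ψ|² + ε⟨X, ∂ψ⟩ + ζ`. -/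
def weightPot (X : Euc d) (ψ : Euc d → ℝ) (ε ζ : ℝ) (x : Euc d) : ℝ :=
  ε ^ 2 * (∑ k, pd k ψ x * pd k ψ x) + ε * (∑ k, X k * pd k ψ x) + ζ

/-- The real weight `e^{εψ/h}`. -/
def expWeight (ψ : Euc d → ℝ) (ε h : ℝ) (x : Euc d) : ℝ := Real.exp (ε * ψ x / h)

variable {X : Euc d} {ψ : Euc d → ℝ} {ε h : ℝ}

lemma contDiff_weightField (hψ : ContDiff ℝ ∞ ψ) (k : Fin d) :
    ContDiff ℝ ∞ (weightField X ψ ε k) :=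
  (contDiff_const.mul (contDiff_pd hψ k)).add contDiff_const

lemma contDiff_weightPot (hψ : ContDiff ℝ ∞ ψ) (ζ : ℝ) : ContDiff ℝ ∞ (weightPot X ψ ε ζ) :=
  ((contDiff_const.mul (ContDiff.sum fun k _ => (contDiff_pd hψ k).mul (contDiff_pd hψ k))).add
    (contDiff_const.mul (ContDiff.sum fun k _ => contDiff_const.mul (contDiff_pd hψ k)))).add
    contDiff_const

lemma contDiff_expWeight (hψ : ContDiff ℝ ∞ ψ) : ContDiff ℝ ∞ (expWeight ψ ε h) :=
  ((contDiff_const.mul hψ).div_const h).exp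

lemma pd_weightField (hψ : ContDiff ℝ ∞ ψ) (j k : Fin d) (x : Euc d) :
    pd j (weightField X ψ ε k) x = 2 * ε * pd j (pd k ψ) x := by
  unfold weightField
  rw [pd_add (contDiff_const.mul (contDiff_pd hψ k)) contDiff_const,
    pd_const_mul _ (contDiff_pd hψ k), pd_const, add_zero]

/-- This is `∇V = ε ∂²ψ Y`, with the same field `Y` as in the drift. It turns the zero-order
commutator term `⟨∇V, Y⟩` into `ε ∂²ψ(Y, Y)`, and it does not see `ζ`. -/
lemma pd_weightPot (hψ : ContDiff ℝ ∞ ψ) (ζ : ℝ) (j : Fin d) (x : Euc d) :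
    pd j (weightPot X ψ ε ζ) x = ε * ∑ k, weightField X ψ ε k x * pd j (pd k ψ) x := by
  have h1 := fun k => contDiff_pd hψ k
  have h2 : ∀ k, ContDiff ℝ ∞ fun x => pd k ψ x * pd k ψ x := fun k => (h1 k).mul (h1 k)
  have h3 : ∀ k, ContDiff ℝ ∞ fun x => X k * pd k ψ x := fun k => contDiff_const.mul (h1 k)
  have h4 : ContDiff ℝ ∞ fun x => ∑ k, pd k ψ x * pd k ψ x := ContDiff.sum fun k _ => h2 k
  have h5 : ContDiff ℝ ∞ fun x => ∑ k, X k * pd k ψ x := ContDiff.sum fun k _ => h3 k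
  unfold weightPot
  rw [pd_add ((contDiff_const.mul h4).add (contDiff_const.mul h5)) contDiff_const,
    pd_add (contDiff_const.mul h4) (contDiff_const.mul h5), pd_const_mul _ h4, pd_const_mul _ h5,
    pd_const, pd_sum fun k _ => h2 k, pd_sum fun k _ => h3 k, Finset.mul_sum, Finset.mul_sum,
    Finset.mul_sum, add_zero, ← Finset.sum_add_distrib]
  refine Finset.sum_congr rfl fun k _ => ?_
  rw [pd_mul (h1 k) (h1 k), pd_const_mul _ (h1 k), weightField]
  ring

lemma pd_expWeight (hψ : ContDiff ℝ ∞ ψ) (j : Fin d) (x : Euc d) :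
    pd j (expWeight ψ ε h) x = expWeight ψ ε h x * (ε / h * pd j ψ x) := by
  have h1 : HasFDerivAt (fun y => ε * ψ y / h) ((ε / h) • fderiv ℝ ψ x) x := by
    have := ((differentiableAt_of_contDiff_top hψ x).hasFDerivAt).const_mul (ε / h)
    refine this.congr_of_eventuallyEq (Filter.Eventually.of_forall fun y => ?_)
    simp only
    ring
  unfold expWeight pd
  rw [h1.exp.fderiv]
  simp

lemma pd_expWeight_mul (hψ : ContDiff ℝ ∞ ψ) {a : Euc d → ℝ} (ha : ContDiff ℝ ∞ a) (j : Fin d)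
    (x : Euc d) : pd j (fun y => expWeight ψ ε h y * a y) x =
      expWeight ψ ε h x * (ε / h * (pd j ψ x * a x) + pd j a x) := by
  rw [pd_mul (contDiff_expWeight hψ) ha, pd_expWeight hψ]
  ring

lemma pd_pd_expWeight_mul (hψ : ContDiff ℝ ∞ ψ) {a : Euc d → ℝ} (ha : ContDiff ℝ ∞ a)
    (j : Fin d) (x : Euc d) : pd j (pd j (fun y => expWeight ψ ε h y * a y)) x =
      expWeight ψ ε h x * ((ε / h) ^ 2 * a x * (pd j ψ x * pd j ψ x)
        + 2 * (ε / h) * (pd j ψ x * pd j a x) + ε / h * a x * pd j (pd j ψ) x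
        + pd j (pd j a) x) := by
  have h1 := contDiff_pd hψ j
  have h2 := contDiff_pd ha j
  rw [show pd j (fun y => expWeight ψ ε h y * a y) = _ from funext (pd_expWeight_mul hψ ha j),
    pd_expWeight_mul hψ ((contDiff_const.mul (h1.mul ha)).add h2),
    pd_add (contDiff_const.mul (h1.mul ha)) h2, pd_const_mul _ (h1.mul ha), pd_mul h1 ha]
  ring

/-- Conjugating the real operator `-h²Δ + h⟨X, ∂⟩ - ζ` by the weight. -/
lemma symPart_add_skewPart (hψ : ContDiff ℝ ∞ ψ) {a : Euc d → ℝ} (ha : ContDiff ℝ ∞ a)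
    (hh : h ≠ 0) (ζ : ℝ) (x : Euc d) :
    symPart h (weightPot X ψ ε ζ) (fun y => expWeight ψ ε h y * a y) x +
      skewPart h (weightField X ψ ε) (fun y => expWeight ψ ε h y * a y) x =
    expWeight ψ ε h x * (-h ^ 2 * (∑ j, pd j (pd j a) x) + h * (∑ j, X j * pd j a x)
      - ζ * a x) := by
  unfold symPart skewPart
  simp_rw [pd_pd_expWeight_mul hψ ha, pd_expWeight_mul hψ ha, pd_weightField hψ]
  have e1 : ∑ j, expWeight ψ ε h x * ((ε / h) ^ 2 * a x * (pd j ψ x * pd j ψ x)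
        + 2 * (ε / h) * (pd j ψ x * pd j a x) + ε / h * a x * pd j (pd j ψ) x
        + pd j (pd j a) x) =
      expWeight ψ ε h x * ((ε / h) ^ 2 * a x * (∑ j, pd j ψ x * pd j ψ x)
        + 2 * (ε / h) * (∑ j, pd j ψ x * pd j a x) + ε / h * a x * (∑ j, pd j (pd j ψ) x)
        + ∑ j, pd j (pd j a) x) := by
    simp only [← Finset.mul_sum, Finset.sum_add_distrib]
  have e2 : ∑ k, weightField X ψ ε k x *
      (expWeight ψ ε h x * (ε / h * (pd k ψ x * a x) + pd k a x)) =
      expWeight ψ ε h x * (2 * ε * (ε / h) * a x * (∑ j, pd j ψ x * pd j ψ x)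
        + 2 * ε * (∑ j, pd j ψ x * pd j a x) + ε / h * a x * (∑ j, X j * pd j ψ x)
        + ∑ j, X j * pd j a x) := by
    simp only [Finset.mul_sum, ← Finset.sum_add_distrib]
    refine Finset.sum_congr rfl fun k _ => ?_
    rw [weightField]
    ring
  -- The terms `2hε ⟨∂ψ, ∂a⟩` and `hε a Δψ` cancel between the two parts, and `V` is exactly what
  -- removes the remaining zero-order terms except `ζ a`.
  rw [e1, e2, ← Finset.mul_sum, weightPot]
  field_simp
  ring

end Conjugation

/-! ### Real and imaginary parts -/

section Complex

variable {d : ℕ} {u : Euc d → ℂ}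

lemma contDiff_re (hu : ContDiff ℝ ∞ u) : ContDiff ℝ ∞ fun x => (u x).re :=
  Complex.reCLM.contDiff.comp hu

lemma contDiff_im (hu : ContDiff ℝ ∞ u) : ContDiff ℝ ∞ fun x => (u x).im :=
  Complex.imCLM.contDiff.comp hu

lemma fderiv_re (hu : ContDiff ℝ ∞ u) (x w : Euc d) :
    fderiv ℝ (fun x => (u x).re) x w = (fderiv ℝ u x w).re := by
  have := (Complex.reCLM.hasFDerivAt (x := u x)).comp x
    (differentiableAt_of_contDiff_top hu x).hasFDerivAt
  change fderiv ℝ (Complex.reCLM ∘ u) x w = _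
  rw [this.fderiv]
  rfl

lemma fderiv_im (hu : ContDiff ℝ ∞ u) (x w : Euc d) :
    fderiv ℝ (fun x => (u x).im) x w = (fderiv ℝ u x w).im := by
  have := (Complex.imCLM.hasFDerivAt (x := u x)).comp x
    (differentiableAt_of_contDiff_top hu x).hasFDerivAt
  change fderiv ℝ (Complex.imCLM ∘ u) x w = _
  rw [this.fderiv]
  rfl

lemma pd_re (hu : ContDiff ℝ ∞ u) (j : Fin d) (x : Euc d) :
    pd j (fun x => (u x).re) x = (pd j u x).re := fderiv_re hu x _

lemma pd_im (hu : ContDiff ℝ ∞ u) (j : Fin d) (x : Euc d) :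
    pd j (fun x => (u x).im) x = (pd j u x).im := fderiv_im hu x _

lemma D_eq (j : Fin d) (u : Euc d → ℂ) (x : Euc d) : D j u x = -Complex.I * pd j u x := by
  simp [D, pd]

lemma contDiff_D (hu : ContDiff ℝ ∞ u) (j : Fin d) : ContDiff ℝ ∞ (D j u) :=
  contDiff_const.mul (contDiff_pd hu j)

lemma D_D_eq (hu : ContDiff ℝ ∞ u) (j : Fin d) (x : Euc d) :
    D j (D j u) x = -pd j (pd j u) x := by
  rw [D_eq, show D j u = fun x => -Complex.I * pd j u x from funext (D_eq j u)]
  have : pd j (fun x => -Complex.I * pd j u x) x = -Complex.I * pd j (pd j u) x := by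
    change fderiv ℝ (fun x => -Complex.I * pd j u x) x _ = -Complex.I * fderiv ℝ (pd j u) x _
    rw [fderiv_const_mul (differentiableAt_of_contDiff_top (contDiff_pd hu j) x)]
    rfl
  rw [this, ← mul_assoc, neg_mul_neg, Complex.I_mul_I]
  ring

variable (X : Euc d) (z : ℂ) (h : ℝ)

/-- As `i D_j = ∂_j`, the drift is a real operator; only `Im z` couples the real and imaginary parts
of `u`. -/
lemma Pz_eq (hu : ContDiff ℝ ∞ u) (x : Euc d) :
    Pz X z h u x = -(h : ℂ) ^ 2 * (∑ j, pd j (pd j u) x) + h * (∑ j, (X j : ℂ) * pd j u x)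
      - z * u x := by
  rw [Pz, hDsq, XhD]
  simp_rw [D_D_eq hu, D_eq]
  have e : Complex.I * ∑ j, (X j : ℂ) * ((h : ℂ) * (-Complex.I * pd j u x)) =
      h * ∑ j, (X j : ℂ) * pd j u x := by
    rw [Finset.mul_sum, Finset.mul_sum]
    refine Finset.sum_congr rfl fun j _ => ?_
    linear_combination -(X j : ℂ) * h * pd j u x * Complex.I_mul_I
  rw [e, ← Finset.mul_sum, Finset.sum_neg_distrib]
  ring

lemma contDiff_Pz (hu : ContDiff ℝ ∞ u) : ContDiff ℝ ∞ (Pz X z h u) := by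
  rw [show Pz X z h u = _ from funext (Pz_eq X z h hu)]
  exact ((contDiff_const.mul (ContDiff.sum fun j _ => contDiff_pd (contDiff_pd hu j) j)).add
    (contDiff_const.mul (ContDiff.sum fun j _ => contDiff_const.mul (contDiff_pd hu j)))).sub
    (contDiff_const.mul hu)

lemma pd_pd_re (hu : ContDiff ℝ ∞ u) (j : Fin d) (x : Euc d) :
    pd j (pd j fun x => (u x).re) x = (pd j (pd j u) x).re := by
  rw [show pd j (fun x => (u x).re) = _ from funext (pd_re hu j), pd_re (contDiff_pd hu j)]

lemma pd_pd_im (hu : ContDiff ℝ ∞ u) (j : Fin d) (x : Euc d) :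
    pd j (pd j fun x => (u x).im) x = (pd j (pd j u) x).im := by
  rw [show pd j (fun x => (u x).im) = _ from funext (pd_im hu j), pd_im (contDiff_pd hu j)]

lemma Pz_re (hu : ContDiff ℝ ∞ u) (x : Euc d) :
    (Pz X z h u x).re = -h ^ 2 * (∑ j, pd j (pd j fun x => (u x).re) x)
      + h * (∑ j, X j * pd j (fun x => (u x).re) x) - z.re * (u x).re + z.im * (u x).im := by
  rw [Pz_eq X z h hu]
  simp_rw [pd_pd_re hu, pd_re hu]
  have e : -(h : ℂ) ^ 2 = ((-h ^ 2 : ℝ) : ℂ) := by push_cast; ring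
  rw [e, Complex.sub_re, Complex.add_re, Complex.re_ofReal_mul, Complex.re_ofReal_mul,
    Complex.mul_re, Complex.re_sum, Complex.re_sum]
  simp_rw [Complex.re_ofReal_mul]
  ring

lemma Pz_im (hu : ContDiff ℝ ∞ u) (x : Euc d) :
    (Pz X z h u x).im = -h ^ 2 * (∑ j, pd j (pd j fun x => (u x).im) x)
      + h * (∑ j, X j * pd j (fun x => (u x).im) x) - z.re * (u x).im - z.im * (u x).re := by
  rw [Pz_eq X z h hu]
  simp_rw [pd_pd_im hu, pd_im hu]
  have e : -(h : ℂ) ^ 2 = ((-h ^ 2 : ℝ) : ℂ) := by push_cast; ring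
  rw [e, Complex.sub_im, Complex.add_im, Complex.im_ofReal_mul, Complex.im_ofReal_mul,
    Complex.mul_im, Complex.im_sum, Complex.im_sum]
  simp_rw [Complex.im_ofReal_mul]
  ring

variable {X z h} {ψ : Euc d → ℝ} {ε : ℝ}

lemma weighted_eq (u : Euc d → ℂ) :
    weighted ψ ε h u = fun x => (expWeight ψ ε h x : ℂ) * u x := rfl

lemma contDiff_weighted (hψ : ContDiff ℝ ∞ ψ) (hu : ContDiff ℝ ∞ u) :
    ContDiff ℝ ∞ (weighted ψ ε h u) :=
  (Complex.ofRealCLM.contDiff.comp (contDiff_expWeight hψ)).mul hu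

lemma weighted_re (u : Euc d → ℂ) (x : Euc d) :
    (weighted ψ ε h u x).re = expWeight ψ ε h x * (u x).re := by
  rw [weighted_eq, Complex.re_ofReal_mul]

lemma weighted_im (u : Euc d → ℂ) (x : Euc d) :
    (weighted ψ ε h u x).im = expWeight ψ ε h x * (u x).im := by
  rw [weighted_eq, Complex.im_ofReal_mul]

/-- The real part of the conjugated operator. -/
lemma weighted_Pz_re (hψ : ContDiff ℝ ∞ ψ) (hu : ContDiff ℝ ∞ u) (hh : h ≠ 0) (x : Euc d) :
    (weighted ψ ε h (Pz X z h u) x).re =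
      symPart h (weightPot X ψ ε z.re) (fun y => (weighted ψ ε h u y).re) x +
      skewPart h (weightField X ψ ε) (fun y => (weighted ψ ε h u y).re) x +
      z.im * (weighted ψ ε h u x).im := by
  simp_rw [weighted_re, weighted_im]
  rw [symPart_add_skewPart hψ (contDiff_re hu) hh, Pz_re X z h hu]
  ring

/-- The imaginary part of the conjugated operator. -/
lemma weighted_Pz_im (hψ : ContDiff ℝ ∞ ψ) (hu : ContDiff ℝ ∞ u) (hh : h ≠ 0) (x : Euc d) :
    (weighted ψ ε h (Pz X z h u) x).im =
      symPart h (weightPot X ψ ε z.re) (fun y => (weighted ψ ε h u y).im) x +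
      skewPart h (weightField X ψ ε) (fun y => (weighted ψ ε h u y).im) x -
      z.im * (weighted ψ ε h u x).re := by
  simp_rw [weighted_re, weighted_im]
  rw [symPart_add_skewPart hψ (contDiff_im hu) hh, Pz_im X z h hu]
  ring

end Complex

/-! ### Norms and boundary terms -/

section Estimate

open Filter Topology

variable {d : ℕ} {Ω : Set (Euc d)} {X : Euc d} {ψ : Euc d → ℝ} {u : Euc d → ℂ} {ε h : ℝ} {z : ℂ}

lemma complex_norm_sq (c : ℂ) : ‖c‖ ^ 2 = c.re ^ 2 + c.im ^ 2 := by
  rw [Complex.sq_norm, Complex.normSq_apply]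
  ring

lemma normL2_sq {v : Euc d → ℂ} (hv : Continuous v) :
    normL2 Ω v ^ 2 = ∫ x in Ω, ‖v x‖ ^ 2 := by
  rw [normL2, lpNorm_eq_integral_norm_rpow_toReal (by norm_num) (by norm_num)
    hv.aestronglyMeasurable]
  simp only [ENNReal.toReal_ofNat, Real.rpow_ofNat]
  rw [← Real.rpow_natCast, ← Real.rpow_mul (integral_nonneg fun _ => by positivity)]
  norm_num

/-- The Hessian quadratic form. -/
def hessForm (ψ : Euc d → ℝ) (x : Euc d) (ξ : Fin d → ℝ) : ℝ :=
  ∑ j, ∑ k, pd j (pd k ψ) x * (ξ j * ξ k)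

lemma fderiv_fderiv_eq_hessForm (hψ : ContDiff ℝ ∞ ψ) (x ξ : Euc d) :
    fderiv ℝ (fderiv ℝ ψ) x ξ ξ = hessForm ψ x ξ := by
  have h1 : ∀ j k, pd j (pd k ψ) x = pd j (fderiv ℝ ψ) x (EuclideanSpace.single k 1) := by
    intro j k
    unfold pd
    rw [fderiv_clm_apply ((hψ.fderiv_right (m := ∞) (by simp)).differentiable (by simp) x)
      (differentiableAt_const _)]
    simp
  have h2 : ξ = ∑ j, ξ j • EuclideanSpace.single j (1 : ℝ) := by
    ext i
    simp [Finset.sum_apply, Pi.single_apply]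
  rw [fderiv_eq_sum_pd, sum_apply, hessForm]
  refine Finset.sum_congr rfl fun j _ => ?_
  conv_lhs => rw [h2]
  simp only [smul_apply, map_sum, map_smul, ← h1, smul_eq_mul]
  refine Finset.sum_congr rfl fun k _ => ?_
  simp [Finset.sum_apply, Pi.single_apply]
  ring

/-- The density of the commutator term. -/
def commDensity (X : Euc d) (ψ : Euc d → ℝ) (ε h : ℝ) (p : Euc d → ℝ) (x : Euc d) : ℝ :=
  4 * h ^ 3 * ε * hessForm ψ x (fun j => pd j p x)
    + h * ε * hessForm ψ x (fun j => weightField X ψ ε j x) * p x ^ 2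
    - h ^ 3 * ε * (∑ j, pd j (pd j fun y => ∑ k, pd k (pd k ψ) y) x) * p x ^ 2

lemma contDiff_hessForm (hψ : ContDiff ℝ ∞ ψ) {ξ : Fin d → Euc d → ℝ}
    (hξ : ∀ j, ContDiff ℝ ∞ (ξ j)) : ContDiff ℝ ∞ fun x => hessForm ψ x (fun j => ξ j x) :=
  ContDiff.sum fun j _ => ContDiff.sum fun k _ =>
    (contDiff_pd (contDiff_pd hψ k) j).mul ((hξ j).mul (hξ k))

lemma contDiff_laplacian (hψ : ContDiff ℝ ∞ ψ) : ContDiff ℝ ∞ fun y => ∑ k, pd k (pd k ψ) y :=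
  ContDiff.sum fun k _ => contDiff_pd (contDiff_pd hψ k) k

lemma contDiff_commDensity (hψ : ContDiff ℝ ∞ ψ) {p : Euc d → ℝ} (hp : ContDiff ℝ ∞ p) :
    ContDiff ℝ ∞ (commDensity X ψ ε h p) :=
  ((contDiff_const.mul (contDiff_hessForm hψ fun j => contDiff_pd hp j)).add
    ((contDiff_const.mul (contDiff_hessForm hψ fun j => contDiff_weightField hψ j)).mul
      (hp.pow 2))).sub
    ((contDiff_const.mul (contDiff_laplacian (contDiff_laplacian hψ))).mul (hp.pow 2))

/-- The Rellich identity for `Y = 2ε∂ψ + X`: the constant field `X` has no derivatives, so every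
interior term carries a factor `hε`. -/
lemma IsBoundedSmoothDomain.integral_symPart_mul_skewPart_weight (hΩ : IsBoundedSmoothDomain Ω)
    (hψ : ContDiff ℝ ∞ ψ) {p : Euc d → ℝ} (hp : ContDiff ℝ ∞ p)
    (h0 : ∀ y ∈ frontier Ω, p y = 0) (ζ : ℝ) :
    ∫ x in Ω, 2 * (symPart h (weightPot X ψ ε ζ) p x * skewPart h (weightField X ψ ε) p x) =
      (∫ x in Ω, commDensity X ψ ε h p x) -
      h ^ 3 * ∫ x in frontier Ω, (∑ j, weightField X ψ ε j x * outwardNormal Ω x j) *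
        fderiv ℝ p x (outwardNormal Ω x) ^ 2 ∂μHE[d - 1] := by
  rw [hΩ.integral_symPart_mul_skewPart (fun k => contDiff_weightField hψ k)
    (contDiff_weightPot hψ ζ) hp h0]
  congr 2
  ext x
  have hdiv : (fun y => ∑ k, pd k (weightField X ψ ε k) y) =
      fun y => (2 * ε) * ∑ k, pd k (pd k ψ) y := by
    ext y
    simp_rw [pd_weightField hψ, Finset.mul_sum]
  have hlap : ∀ j, pd j (pd j fun y => (2 * ε) * ∑ k, pd k (pd k ψ) y) x =
      2 * ε * pd j (pd j fun y => ∑ k, pd k (pd k ψ) y) x := by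
    intro j
    rw [show pd j (fun y => (2 * ε) * ∑ k, pd k (pd k ψ) y) = _ from
      funext (pd_const_mul (2 * ε) (contDiff_laplacian hψ) j),
      pd_const_mul _ (contDiff_pd (contDiff_laplacian hψ) j)]
  rw [hdiv]
  simp_rw [hlap, pd_weightField hψ, pd_weightPot hψ]
  rw [← Finset.mul_sum]
  have e1 : ∑ j, ∑ k, 2 * ε * pd j (pd k ψ) x * (pd j p x * pd k p x) =
      2 * ε * hessForm ψ x (fun j => pd j p x) := by
    simp only [hessForm, Finset.mul_sum]
    exact Finset.sum_congr rfl fun j _ => Finset.sum_congr rfl fun k _ => by ring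
  have e2 : ∑ k, ε * (∑ l, weightField X ψ ε l x * pd k (pd l ψ) x) * weightField X ψ ε k x =
      ε * hessForm ψ x (fun j => weightField X ψ ε j x) := by
    simp only [hessForm, Finset.mul_sum, Finset.sum_mul]
    exact Finset.sum_congr rfl fun j _ => Finset.sum_congr rfl fun k _ => by ring
  rw [e1, e2, commDensity]
  ring

lemma inner_weightField (x ν : Euc d) :
    ⟪(2 * ε) • gradient ψ x + X, ν⟫_ℝ = ∑ j, weightField X ψ ε j x * ν j := by
  rw [inner_add_left, real_inner_smul_left, inner_gradient, fderiv_eq_sum_pd, Finset.mul_sum,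
    PiLp.inner_apply, ← Finset.sum_add_distrib]
  refine Finset.sum_congr rfl fun j _ => ?_
  simp only [weightField, smul_eq_mul, RCLike.inner_apply, conj_trivial]
  ring

/-- Where `u = 0`, the derivative of the weight is multiplied by zero, so the weight commutes with
`∂_ν`. -/
lemma boundary_integrand_eq (hψ : ContDiff ℝ ∞ ψ) (hu : ContDiff ℝ ∞ u)
    {x : Euc d} (hx : u x = 0) :
    ‖weighted ψ ε h (normalDeriv Ω u) x‖ ^ 2 =
      fderiv ℝ (fun y => (weighted ψ ε h u y).re) x (outwardNormal Ω x) ^ 2 +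
      fderiv ℝ (fun y => (weighted ψ ε h u y).im) x (outwardNormal Ω x) ^ 2 := by
  have key : ∀ a : Euc d → ℝ, ContDiff ℝ ∞ a → a x = 0 → ∀ w,
      fderiv ℝ (fun y => expWeight ψ ε h y * a y) x w = expWeight ψ ε h x * fderiv ℝ a x w := by
    intro a ha h0 w
    rw [fderiv_fun_mul (differentiableAt_of_contDiff_top (contDiff_expWeight hψ) x)
      (differentiableAt_of_contDiff_top ha x), h0]
    simp
  simp_rw [weighted_re, weighted_im]
  rw [key _ (contDiff_re hu) (by simp [hx]), key _ (contDiff_im hu) (by simp [hx]),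
    fderiv_re hu, fderiv_im hu, complex_norm_sq, weighted_re, weighted_im, normalDeriv]

/-- Continuity of the normal on the boundary makes `gammaPlus` closed, which gives measurability,
and makes the integrand integrable. -/
lemma IsBoundedSmoothDomain.boundaryTerm_add (hΩ : IsBoundedSmoothDomain Ω)
    (hψ : ContDiff ℝ ∞ ψ) (hu : ContDiff ℝ ∞ u) :
    boundaryTerm Ω X ψ ε h u (boundaryMinus Ω X) + boundaryTerm Ω X ψ ε h u (gammaPlus Ω X) =
      boundaryTerm Ω X ψ ε h u (frontier Ω) := by
  have hν := hΩ.continuousOn_outwardNormal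
  have hin : ContinuousOn (fun x => ⟪X, outwardNormal Ω x⟫_ℝ) (frontier Ω) :=
    continuousOn_const.inner hν
  have hg : gammaPlus Ω X = frontier Ω ∩ (fun x => ⟪X, outwardNormal Ω x⟫_ℝ) ⁻¹' Set.Ici 0 := by
    ext x
    constructor
    · rintro (⟨h1, h2⟩ | ⟨h1, h2⟩)
      · exact ⟨h1, h2.le⟩
      · exact ⟨h1, h2.ge⟩
    · rintro ⟨h1, h2⟩
      rcases (show 0 ≤ ⟪X, outwardNormal Ω x⟫_ℝ from h2).lt_or_eq with h3 | h3
      · exact Or.inl ⟨h1, h3⟩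
      · exact Or.inr ⟨h1, h3.symm⟩
  have hcl : IsClosed (gammaPlus Ω X) := by
    rw [hg]
    exact hin.preimage_isClosed_of_isClosed isClosed_frontier isClosed_Ici
  have hun : frontier Ω = boundaryMinus Ω X ∪ gammaPlus Ω X := by
    rw [hg]
    ext x
    constructor
    · intro hx
      rcases lt_or_ge ⟪X, outwardNormal Ω x⟫_ℝ 0 with h1 | h1
      · exact Or.inl ⟨hx, h1⟩
      · exact Or.inr ⟨hx, h1⟩
    · rintro (h1 | h1)
      · exact h1.1
      · exact h1.1
  have hdis : Disjoint (boundaryMinus Ω X) (gammaPlus Ω X) := by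
    rw [hg, Set.disjoint_left]
    intro x h1 h2
    exact absurd h1.2 (not_lt.2 h2.2)
  have hgrad : Continuous (gradient ψ) :=
    (InnerProductSpace.toDual ℝ (Euc d)).symm.continuous.comp (hψ.continuous_fderiv (by simp))
  set g : Euc d → ℝ := fun x => ⟪(2 * ε) • gradient ψ x + X, outwardNormal Ω x⟫_ℝ *
    ‖weighted ψ ε h (normalDeriv Ω u) x‖ ^ 2 with hg_def
  have hint : IntegrableOn g (frontier Ω) (μHE[d - 1]) := by
    refine hΩ.integrableOn_frontier ?_
    have h1 : ContinuousOn (normalDeriv Ω u) (frontier Ω) :=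
      (hu.continuous_fderiv (by simp)).continuousOn.clm_apply hν
    have h2 : ContinuousOn (weighted ψ ε h (normalDeriv Ω u)) (frontier Ω) :=
      (Complex.continuous_ofReal.comp
        (contDiff_expWeight hψ).continuous).continuousOn.mul h1
    have h3 : Continuous fun x => (2 * ε) • gradient ψ x + X :=
      (hgrad.const_smul (2 * ε)).add continuous_const
    have h4 : ContinuousOn (fun x => ⟪(2 * ε) • gradient ψ x + X, outwardNormal Ω x⟫_ℝ)
        (frontier Ω) := ContinuousOn.inner (𝕜 := ℝ) h3.continuousOn hν
    exact h4.mul (h2.norm.pow 2)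
  have hs1 : boundaryMinus Ω X ⊆ frontier Ω := fun x hx => hx.1
  have hs2 : gammaPlus Ω X ⊆ frontier Ω := hg ▸ Set.inter_subset_left
  have hadd := setIntegral_union hdis hcl.measurableSet (hint.mono_set hs1) (hint.mono_set hs2)
  rw [← hun] at hadd
  exact hadd.symm

/-- The integrated commutator inequality. -/
lemma IsBoundedSmoothDomain.commutator_le (hΩ : IsBoundedSmoothDomain Ω)
    (hψ : ContDiff ℝ ∞ ψ) (hu : ContDiff ℝ ∞ u) (h0 : ∀ y ∈ frontier Ω, u y = 0) (hh : h ≠ 0)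
    (z : ℂ) :
    (∫ x in Ω, (commDensity X ψ ε h (fun y => (weighted ψ ε h u y).re) x +
      commDensity X ψ ε h (fun y => (weighted ψ ε h u y).im) x)) -
      h ^ 3 * boundaryTerm Ω X ψ ε h u (frontier Ω) ≤
    normL2 Ω (weighted ψ ε h (Pz X z h u)) ^ 2 := by
  have hv : ContDiff ℝ ∞ (weighted ψ ε h u) := contDiff_weighted hψ hu
  set p : Euc d → ℝ := fun y => (weighted ψ ε h u y).re with hp_def
  set q : Euc d → ℝ := fun y => (weighted ψ ε h u y).im with hq_def
  have hp : ContDiff ℝ ∞ p := contDiff_re hv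
  have hq : ContDiff ℝ ∞ q := contDiff_im hv
  have hp0 : ∀ y ∈ frontier Ω, p y = 0 := fun y hy => by simp [hp_def, weighted_re, h0 y hy]
  have hq0 : ∀ y ∈ frontier Ω, q y = 0 := fun y hy => by simp [hq_def, weighted_im, h0 y hy]
  set V := weightPot X ψ ε z.re
  set Y := weightField X ψ ε
  have hV : ContDiff ℝ ∞ V := contDiff_weightPot hψ _
  have hY : ∀ k, ContDiff ℝ ∞ (Y k) := fun k => contDiff_weightField hψ k
  have hPc := (contDiff_weighted (ε := ε) (h := h) hψ (contDiff_Pz X z h hu)).continuous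
  have hAp := (contDiff_symPart hV hp h).continuous
  have hAq := (contDiff_symPart hV hq h).continuous
  have hMp := (contDiff_skewPart hY hp h).continuous
  have hMq := (contDiff_skewPart hY hq h).continuous
  have i1 : IntegrableOn (fun x => 2 * (symPart h V p x * skewPart h Y p x)) Ω :=
    hΩ.integrableOn (by fun_prop)
  have i2 : IntegrableOn (fun x => 2 * (symPart h V q x * skewPart h Y q x)) Ω :=
    hΩ.integrableOn (by fun_prop)
  have i3 : IntegrableOn (fun x => q x * symPart h V p x - p x * symPart h V q x) Ω :=
    hΩ.integrableOn ((hq.continuous.mul hAp).sub (hp.continuous.mul hAq))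
  have i12 : IntegrableOn (fun x => 2 * (symPart h V p x * skewPart h Y p x) +
      2 * (symPart h V q x * skewPart h Y q x)) Ω := i1.add i2
  have hmono : ∫ x in Ω, ((2 * (symPart h V p x * skewPart h Y p x) +
      2 * (symPart h V q x * skewPart h Y q x)) +
      2 * z.im * (q x * symPart h V p x - p x * symPart h V q x)) ≤
      ∫ x in Ω, ‖weighted ψ ε h (Pz X z h u) x‖ ^ 2 := by
    refine integral_mono (i12.add (i3.const_mul _))
      (hΩ.integrableOn (hPc.norm.pow 2)) fun x => ?_
    simp only
    rw [complex_norm_sq, weighted_Pz_re hψ hu hh, weighted_Pz_im hψ hu hh]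
    change _ ≤ (symPart h V p x + skewPart h Y p x + z.im * q x) ^ 2 +
      (symPart h V q x + skewPart h Y q x - z.im * p x) ^ 2
    -- The discarded squares are those of `Ap`, `Aq`, `Bp + (Im z) q` and `Bq - (Im z) p`; what
    -- remains is the cross terms.
    nlinarith [sq_nonneg (symPart h V p x), sq_nonneg (skewPart h Y p x + z.im * q x),
      sq_nonneg (symPart h V q x), sq_nonneg (skewPart h Y q x - z.im * p x)]
  rw [normL2_sq hPc]
  refine le_trans (le_of_eq ?_) hmono
  rw [integral_add i12 (i3.const_mul _), integral_add i1 i2, integral_const_mul (2 * z.im),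
    hΩ.integral_green hp hq hp0 hq0, mul_zero, add_zero,
    hΩ.integral_symPart_mul_skewPart_weight hψ hp hp0,
    hΩ.integral_symPart_mul_skewPart_weight hψ hq hq0,
    integral_add (hΩ.integrableOn (contDiff_commDensity hψ hp).continuous)
      (hΩ.integrableOn (contDiff_commDensity hψ hq).continuous)]
  have hbd : ∀ {r : Euc d → ℝ}, ContDiff ℝ ∞ r → IntegrableOn (fun x =>
      (∑ j, Y j x * outwardNormal Ω x j) * fderiv ℝ r x (outwardNormal Ω x) ^ 2)
      (frontier Ω) (μHE[d - 1]) := by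
    intro r hr
    have hν := hΩ.continuousOn_outwardNormal
    refine hΩ.integrableOn_frontier (ContinuousOn.mul (continuousOn_finsetSum _ fun j _ =>
      (hY j).continuous.continuousOn.mul ((EuclideanSpace.proj (𝕜 := ℝ)
        j).continuous.comp_continuousOn hν)) ?_)
    exact ((hr.continuous_fderiv (by simp)).continuousOn.clm_apply hν).pow 2
  have hb : boundaryTerm Ω X ψ ε h u (frontier Ω) =
      (∫ x in frontier Ω, (∑ j, Y j x * outwardNormal Ω x j) *
        fderiv ℝ p x (outwardNormal Ω x) ^ 2 ∂μHE[d - 1]) +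
      ∫ x in frontier Ω, (∑ j, Y j x * outwardNormal Ω x j) *
        fderiv ℝ q x (outwardNormal Ω x) ^ 2 ∂μHE[d - 1] := by
    rw [← integral_add (hbd hp) (hbd hq), boundaryTerm]
    refine setIntegral_congr_fun hΩ.isCompact_frontier.measurableSet fun x hx => ?_
    simp only
    rw [inner_weightField, boundary_integrand_eq hψ hu (h0 x hx)]
    ring
  rw [hb]
  ring

/-- The estimate with an abstract density on the left, under a lower bound on the Hessian. -/
lemma IsBoundedSmoothDomain.carleman_density (hΩ : IsBoundedSmoothDomain Ω) (hX : X ≠ 0)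
    (hψ : ContDiff ℝ ∞ ψ) {c : ℝ} (hc : 0 < c)
    (hH : ∀ x ∈ Ω, ∀ ξ : Fin d → ℝ, c * (∑ j, X j * ξ j) ^ 2 ≤ hessForm ψ x ξ) :
    ∃ c₁ > 0, ∃ δ > 0, ∃ h₀ > 0, ∀ (z : ℂ) (h ε : ℝ), 0 < h → h < h₀ → 0 < ε → ε ≤ δ →
      ∀ u : Euc d → ℂ, ContDiff ℝ ∞ u → (∀ x ∈ frontier Ω, u x = 0) →
      -h ^ 3 * boundaryTerm Ω X ψ ε h u (boundaryMinus Ω X) +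
        h * ε * (∫ x in Ω, (4 * h ^ 2 *
          (hessForm ψ x (fun j => pd j (fun y => (weighted ψ ε h u y).re) x) +
          hessForm ψ x (fun j => pd j (fun y => (weighted ψ ε h u y).im) x)) +
          c₁ * ‖weighted ψ ε h u x‖ ^ 2)) ≤
      normL2 Ω (weighted ψ ε h (Pz X z h u)) ^ 2 +
        h ^ 3 * boundaryTerm Ω X ψ ε h u (gammaPlus Ω X) := by
  have hXn : 0 < ‖X‖ := norm_pos_iff.2 hX
  have hdir : ContDiff ℝ ∞ fun x => ∑ k, X k * pd k ψ x :=
    ContDiff.sum fun k _ => contDiff_const.mul (contDiff_pd hψ k)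
  have hL := contDiff_laplacian (contDiff_laplacian hψ)
  obtain ⟨K₁, hK₁⟩ := hΩ.isCompact_closure.exists_bound_of_continuousOn hdir.continuous.continuousOn
  obtain ⟨K₂, hK₂⟩ := hΩ.isCompact_closure.exists_bound_of_continuousOn hL.continuous.continuousOn
  -- The choice of `δ` gives `⟨X, Y⟩ ≥ ‖X‖²/2`, so `∂²ψ(Y, Y) ≥ c‖X‖⁴/4 = 2c₁`. The choice of `h₀`
  -- makes `h² Δ²ψ ≤ c₁`, using `h² ≤ h`, and half of the lower bound remains.
  set c₁ := c * ‖X‖ ^ 4 / 8 with hc₁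
  have hc₁pos : 0 < c₁ := by positivity
  refine ⟨c₁, hc₁pos, ‖X‖ ^ 2 / (4 * (|K₁| + 1)), by positivity,
    min 1 (c₁ / (|K₂| + 1)), by positivity, fun z h ε hh hh₀ hε hεδ u hu h0 => ?_⟩
  have hmain := hΩ.commutator_le (X := X) (ε := ε) hψ hu h0 hh.ne' z
  rw [← hΩ.boundaryTerm_add hψ hu] at hmain
  have hv : ContDiff ℝ ∞ (weighted ψ ε h u) := contDiff_weighted hψ hu
  have hp := contDiff_re hv
  have hq := contDiff_im hv
  have hh1 : h ≤ 1 := hh₀.le.trans (min_le_left _ _)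
  have hh2 : h * (|K₂| + 1) ≤ c₁ :=
    (le_div_iff₀ (by positivity)).1 (hh₀.le.trans (min_le_right _ _))
  have hε2 : ε * (4 * (|K₁| + 1)) ≤ ‖X‖ ^ 2 := (le_div_iff₀ (by positivity)).1 hεδ
  have hcoef : ∀ x ∈ Ω, c₁ ≤ hessForm ψ x (fun j => weightField X ψ ε j x) -
      h ^ 2 * ∑ j, pd j (pd j fun y => ∑ k, pd k (pd k ψ) y) x := by
    intro x hx
    have hXY : ∑ j, X j * weightField X ψ ε j x =
        ‖X‖ ^ 2 + 2 * ε * ∑ k, X k * pd k ψ x := by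
      rw [← sum_sq_eq_norm_sq, Finset.mul_sum, ← Finset.sum_add_distrib]
      exact Finset.sum_congr rfl fun j _ => by rw [weightField]; ring
    have b1 : |∑ k, X k * pd k ψ x| ≤ |K₁| :=
      (hK₁ x (subset_closure hx)).trans (le_abs_self _)
    have b2 : |∑ j, pd j (pd j fun y => ∑ k, pd k (pd k ψ) y) x| ≤ |K₂| :=
      (hK₂ x (subset_closure hx)).trans (le_abs_self _)
    have b3 : ‖X‖ ^ 2 / 2 ≤ ∑ j, X j * weightField X ψ ε j x := by
      rw [hXY]
      nlinarith [(abs_le.1 b1).1]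
    have b4 : (‖X‖ ^ 2 / 2) ^ 2 ≤ (∑ j, X j * weightField X ψ ε j x) ^ 2 := by gcongr
    have b5 := hH x hx fun j => weightField X ψ ε j x
    have b6 : h ^ 2 * ∑ j, pd j (pd j fun y => ∑ k, pd k (pd k ψ) y) x ≤ c₁ := by
      calc h ^ 2 * ∑ j, pd j (pd j fun y => ∑ k, pd k (pd k ψ) y) x ≤ h ^ 2 * |K₂| := by
            gcongr
            exact (le_abs_self _).trans b2
        _ ≤ h * (|K₂| + 1) := by
            nlinarith [mul_nonneg (mul_nonneg hh.le (abs_nonneg K₂)) (sub_nonneg.2 hh1)]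
        _ ≤ c₁ := hh2
    have b7 : c * (‖X‖ ^ 2 / 2) ^ 2 ≤ c * (∑ j, X j * weightField X ψ ε j x) ^ 2 := by gcongr
    have b8 : c * (‖X‖ ^ 2 / 2) ^ 2 = 2 * c₁ := by rw [hc₁]; ring
    linarith
  have hcont := fun (r : Euc d → ℝ) (hr : ContDiff ℝ ∞ r) =>
    (contDiff_hessForm hψ fun j => contDiff_pd hr j).continuous
  have hle : h * ε * (∫ x in Ω, (4 * h ^ 2 *
          (hessForm ψ x (fun j => pd j (fun y => (weighted ψ ε h u y).re) x) +
          hessForm ψ x (fun j => pd j (fun y => (weighted ψ ε h u y).im) x)) +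
          c₁ * ‖weighted ψ ε h u x‖ ^ 2)) ≤
      ∫ x in Ω, (commDensity X ψ ε h (fun y => (weighted ψ ε h u y).re) x +
        commDensity X ψ ε h (fun y => (weighted ψ ε h u y).im) x) := by
    rw [← integral_const_mul]
    refine setIntegral_mono_on (hΩ.integrableOn ?_) (hΩ.integrableOn ?_)
      hΩ.isOpen.measurableSet fun x hx => ?_
    · exact continuous_const.mul ((continuous_const.mul ((hcont _ hp).add (hcont _ hq))).add
        (continuous_const.mul (hv.continuous.norm.pow 2)))
    · exact (contDiff_commDensity hψ hp).continuous.add (contDiff_commDensity hψ hq).continuous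
    · rw [complex_norm_sq, commDensity, commDensity]
      have hk := mul_le_mul_of_nonneg_left (hcoef x hx)
        (show 0 ≤ h * ε * ((weighted ψ ε h u x).re ^ 2 + (weighted ψ ε h u x).im ^ 2) by positivity)
      linarith
  linarith

end Estimate

/-! ### The two convexity conditions -/

section Convexity

open Filter Topology

variable {d : ℕ} {Ω : Set (Euc d)} {X : Euc d} {ψ : Euc d → ℝ} {u : Euc d → ℂ} {ε h : ℝ}

lemma sum_mul_sq_le (X : Euc d) (ξ : Fin d → ℝ) :
    (∑ j, X j * ξ j) ^ 2 ≤ ‖X‖ ^ 2 * ∑ j, ξ j ^ 2 := by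
  rw [← sum_sq_eq_norm_sq]
  simpa [sq] using Finset.sum_mul_sq_le_sq_mul_sq Finset.univ (fun j => X j) ξ

/-- Compactness of `closure Ω` times the unit sphere, then homogeneity in `ξ`. -/
lemma LocallyStrictlyConvex.exists_lower_bound (hK : IsCompact (closure Ω))
    (hψ : ContDiff ℝ ∞ ψ) (hc : LocallyStrictlyConvex Ω ψ) :
    ∃ c > 0, ∀ x ∈ Ω, ∀ ξ : Fin d → ℝ, c * ∑ j, ξ j ^ 2 ≤ hessForm ψ x ξ := by
  have hcont : Continuous fun q : Euc d × Euc d => fderiv ℝ (fderiv ℝ ψ) q.1 q.2 q.2 := by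
    have h1 : Continuous (fderiv ℝ (fderiv ℝ ψ)) :=
      (hψ.fderiv_right (m := ∞) (by simp)).continuous_fderiv (by simp)
    exact ((h1.comp continuous_fst).clm_apply continuous_snd).clm_apply continuous_snd
  obtain ⟨c, hcpos, hmin⟩ := (hK.prod (isCompact_sphere (0 : Euc d) 1)).exists_forall_le'
    hcont.continuousOn (a := 0) (by
      rintro ⟨x, ξ⟩ ⟨hx, hξ⟩
      refine hc x hx ξ ?_
      rintro rfl
      simp at hξ)
  refine ⟨c, hcpos, fun x hx ξ => ?_⟩
  set w : Euc d := WithLp.toLp 2 ξ with hw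
  have hsum : ∑ j, ξ j ^ 2 = ‖w‖ ^ 2 := by
    rw [← sum_sq_eq_norm_sq]
    exact Finset.sum_congr rfl fun j _ => sq _
  change _ ≤ hessForm ψ x w
  rw [hsum, ← fderiv_fderiv_eq_hessForm hψ]
  rcases eq_or_ne w 0 with h0 | h0
  · simp [h0]
  · have hn : 0 < ‖w‖ := norm_pos_iff.2 h0
    have := hmin (x, ‖w‖⁻¹ • w) ⟨subset_closure hx, by simp [norm_smul, hn.ne']⟩
    simp only [map_smul, smul_apply, smul_eq_mul] at this
    calc c * ‖w‖ ^ 2 ≤ (‖w‖⁻¹ * (‖w‖⁻¹ * fderiv ℝ (fderiv ℝ ψ) x w w)) * ‖w‖ ^ 2 := by gcongr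
      _ = _ := by field_simp

/-- A function of `⟨x, X⟩` alone has a rank-one Hessian. The representation of `ψ` may be
differentiated because it holds on an open set. -/
lemma IsConvexInDirection.hessForm_eq (hΩ : IsOpen Ω) {ψ₁ : ℝ → ℝ} (hψ₁ : ContDiff ℝ ∞ ψ₁)
    (heq : ∀ x ∈ Ω, ψ x = ψ₁ ⟪x, X⟫_ℝ) {x : Euc d} (hx : x ∈ Ω) (ξ : Fin d → ℝ) :
    hessForm ψ x ξ = deriv (deriv ψ₁) ⟪x, X⟫_ℝ * (∑ j, X j * ξ j) ^ 2 := by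
  have hpd : ∀ (g : ℝ → ℝ), ContDiff ℝ ∞ g → ∀ (j : Fin d) (y : Euc d),
      pd j (fun y => g ⟪y, X⟫_ℝ) y = deriv g ⟪y, X⟫_ℝ * X j := by
    intro g hg j y
    have h1 : HasFDerivAt (fun y : Euc d => ⟪y, X⟫_ℝ) (innerSL ℝ X) y := by
      have := (innerSL ℝ X).hasFDerivAt (x := y)
      refine this.congr_of_eventuallyEq (Eventually.of_forall fun y => ?_)
      simp [real_inner_comm]
    have h2 := ((hg.differentiable (by simp) ⟪y, X⟫_ℝ).hasDerivAt).comp_hasFDerivAt y h1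
    rw [pd, show (fun y => g ⟪y, X⟫_ℝ) = g ∘ fun y : Euc d => ⟪y, X⟫_ℝ from rfl, h2.fderiv]
    simp [EuclideanSpace.inner_single_right]
  have hd : ContDiff ℝ ∞ (deriv ψ₁) := (contDiff_infty_iff_deriv.1 hψ₁).2
  have h1 : ∀ k, ∀ y ∈ Ω, pd k ψ y = deriv ψ₁ ⟪y, X⟫_ℝ * X k := by
    intro k y hy
    have hev : ψ =ᶠ[𝓝 y] fun y => ψ₁ ⟪y, X⟫_ℝ := by
      filter_upwards [hΩ.mem_nhds hy] with y' hy' using heq y' hy'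
    rw [← hpd ψ₁ hψ₁ k y, pd, hev.fderiv_eq, pd]
  have h2 : ∀ j k, pd j (pd k ψ) x = deriv (deriv ψ₁) ⟪x, X⟫_ℝ * X j * X k := by
    intro j k
    have hev : pd k ψ =ᶠ[𝓝 x] fun y => X k * deriv ψ₁ ⟪y, X⟫_ℝ := by
      filter_upwards [hΩ.mem_nhds hx] with y' hy'
      rw [h1 k y' hy', mul_comm]
    have hcd : ContDiff ℝ ∞ fun y : Euc d => deriv ψ₁ ⟪y, X⟫_ℝ :=
      hd.comp (contDiff_id.inner ℝ contDiff_const)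
    rw [pd, hev.fderiv_eq]
    change pd j (fun y => X k * deriv ψ₁ ⟪y, X⟫_ℝ) x = _
    rw [pd_const_mul _ hcd, hpd _ hd]
    ring
  simp_rw [hessForm, h2, sq, Finset.sum_mul_sum, Finset.mul_sum]
  exact Finset.sum_congr rfl fun j _ => Finset.sum_congr rfl fun k _ => by ring

lemma IsConvexInDirection.exists_lower_bound (hΩ : IsOpen Ω) (hK : IsCompact (closure Ω))
    (hc : IsConvexInDirection Ω X ψ) :
    ∃ c > 0, ∀ x ∈ Ω, ∀ ξ : Fin d → ℝ, c * (∑ j, X j * ξ j) ^ 2 ≤ hessForm ψ x ξ := by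
  obtain ⟨ψ₁, hψ₁, hpos, heq⟩ := hc
  have hcont : Continuous fun x : Euc d => deriv (deriv ψ₁) ⟪x, X⟫_ℝ := by
    have h2 : Continuous (deriv (deriv ψ₁)) :=
      (contDiff_infty_iff_deriv.1 (contDiff_infty_iff_deriv.1 hψ₁).2).2.continuous
    exact h2.comp (continuous_id.inner continuous_const)
  obtain ⟨c, hcpos, hmin⟩ := hK.exists_forall_le' hcont.continuousOn (a := 0) hpos
  refine ⟨c, hcpos, fun x hx ξ => ?_⟩
  rw [IsConvexInDirection.hessForm_eq hΩ hψ₁ (fun x hx => heq x (subset_closure hx)) hx]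
  gcongr
  exact hmin x (subset_closure hx)

lemma norm_hD_sq {v : Euc d → ℂ} (hv : ContDiff ℝ ∞ v) (j : Fin d) (x : Euc d) :
    ‖(h : ℂ) * D j v x‖ ^ 2 =
      h ^ 2 * (pd j (fun y => (v y).re) x ^ 2 + pd j (fun y => (v y).im) x ^ 2) := by
  rw [D_eq, pd_re hv, pd_im hv, ← complex_norm_sq, norm_mul, norm_mul, norm_neg, Complex.norm_I,
    one_mul, mul_pow, Complex.norm_real, Real.norm_eq_abs, sq_abs]

lemma norm_XhD_sq {v : Euc d → ℂ} (hv : ContDiff ℝ ∞ v) (x : Euc d) :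
    ‖XhD X h v x‖ ^ 2 = h ^ 2 * ((∑ j, X j * pd j (fun y => (v y).re) x) ^ 2 +
      (∑ j, X j * pd j (fun y => (v y).im) x) ^ 2) := by
  have e : XhD X h v x = (h : ℂ) * -Complex.I * ∑ j, ((X j : ℝ) : ℂ) * pd j v x := by
    rw [XhD, Finset.mul_sum]
    exact Finset.sum_congr rfl fun j _ => by rw [D_eq]; ring
  rw [e, norm_mul, norm_mul, norm_neg, Complex.norm_I, mul_one, mul_pow, Complex.norm_real,
    Real.norm_eq_abs, sq_abs, complex_norm_sq, Complex.re_sum, Complex.im_sum]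
  simp_rw [Complex.re_ofReal_mul, Complex.im_ofReal_mul, pd_re hv, pd_im hv]

lemma contDiff_XhD {v : Euc d → ℂ} (hv : ContDiff ℝ ∞ v) : ContDiff ℝ ∞ (XhD X h v) :=
  ContDiff.sum fun j _ => contDiff_const.mul (contDiff_const.mul (contDiff_D hv j))

lemma IsBoundedSmoothDomain.integrableOn_norm_sq (hΩ : IsBoundedSmoothDomain Ω) {v : Euc d → ℂ}
    (hv : Continuous v) : IntegrableOn (fun x => ‖v x‖ ^ 2) Ω :=
  hΩ.integrableOn (hv.norm.pow 2)

lemma IsBoundedSmoothDomain.normH1_sq (hΩ : IsBoundedSmoothDomain Ω) {v : Euc d → ℂ}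
    (hv : ContDiff ℝ ∞ v) :
    normH1 Ω h v ^ 2 = ∫ x in Ω, (‖v x‖ ^ 2 + h ^ 2 *
      ((∑ j, pd j (fun y => (v y).re) x ^ 2) + ∑ j, pd j (fun y => (v y).im) x ^ 2)) := by
  have hD : ∀ j, Continuous fun x => (h : ℂ) * D j v x := fun j =>
    continuous_const.mul (contDiff_D hv j).continuous
  rw [normH1, Real.sq_sqrt (by positivity), normL2_sq hv.continuous]
  simp_rw [fun j => normL2_sq (Ω := Ω) (hD j)]
  rw [← integral_finsetSum _ fun j _ => hΩ.integrableOn_norm_sq (hD j),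
    ← integral_add (hΩ.integrableOn_norm_sq hv.continuous)
      (integrable_finsetSum _ fun j _ => hΩ.integrableOn_norm_sq (hD j))]
  congr 1
  ext x
  simp_rw [norm_hD_sq hv, ← Finset.mul_sum, Finset.sum_add_distrib]

lemma IsBoundedSmoothDomain.normHX_sq_le (hΩ : IsBoundedSmoothDomain Ω) {v : Euc d → ℂ}
    (hv : ContDiff ℝ ∞ v) :
    normHX Ω X h v ^ 2 ≤ 2 * ∫ x in Ω, (‖v x‖ ^ 2 + h ^ 2 *
      ((∑ j, X j * pd j (fun y => (v y).re) x) ^ 2 +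
        (∑ j, X j * pd j (fun y => (v y).im) x) ^ 2)) := by
  have hXc := (contDiff_XhD (X := X) (h := h) hv).continuous
  simp_rw [← norm_XhD_sq hv]
  rw [integral_add (hΩ.integrableOn_norm_sq hv.continuous) (hΩ.integrableOn_norm_sq hXc), ← normL2_sq hv.continuous, ← normL2_sq hXc, normHX]
  nlinarith [sq_nonneg (normL2 Ω v - normL2 Ω (XhD X h v))]

/-- The common final step: a norm controlled by the Hessian density satisfies the estimate. -/
lemma IsBoundedSmoothDomain.carlemanEstimate_of_le (hΩ : IsBoundedSmoothDomain Ω) (hX : X ≠ 0)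
    (hψ : ContDiff ℝ ∞ ψ) {c : ℝ} (hc : 0 < c)
    (hH : ∀ x ∈ Ω, ∀ ξ : Fin d → ℝ, c * (∑ j, X j * ξ j) ^ 2 ≤ hessForm ψ x ξ)
    {W : ℝ → (Euc d → ℂ) → ℝ}
    (hW : ∀ c₁ > 0, ∃ C > 0, ∀ h > 0, ∀ v : Euc d → ℂ, ContDiff ℝ ∞ v → C * W h v ^ 2 ≤
      ∫ x in Ω, (4 * h ^ 2 * (hessForm ψ x (fun j => pd j (fun y => (v y).re) x) +
        hessForm ψ x (fun j => pd j (fun y => (v y).im) x)) + c₁ * ‖v x‖ ^ 2)) :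
    CarlemanEstimate Ω X ψ W := by
  obtain ⟨c₁, hc₁, δ, hδ, h₀, hh₀, H⟩ := hΩ.carleman_density hX hψ hc hH
  obtain ⟨C, hC, hCW⟩ := hW c₁ hc₁
  refine ⟨C, hC, δ, hδ, h₀, hh₀, fun z h ε hh hlt hε hεδ u hu h0 => ?_⟩
  refine le_trans ?_ (H z h ε hh hlt hε hεδ u hu h0)
  have := mul_le_mul_of_nonneg_left (hCW h hh _ (contDiff_weighted (ε := ε) (h := h) hψ hu))
    (show 0 ≤ h * ε by positivity)
  linarith

lemma continuous_density (hψ : ContDiff ℝ ∞ ψ) {v : Euc d → ℂ} (hv : ContDiff ℝ ∞ v) (h c : ℝ) :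
    Continuous fun x => 4 * h ^ 2 * (hessForm ψ x (fun j => pd j (fun y => (v y).re) x) +
        hessForm ψ x (fun j => pd j (fun y => (v y).im) x)) + c * ‖v x‖ ^ 2 :=
  (continuous_const.mul
    ((contDiff_hessForm hψ fun j => contDiff_pd (contDiff_re hv) j).continuous.add
      (contDiff_hessForm hψ fun j => contDiff_pd (contDiff_im hv) j).continuous)).add
    (continuous_const.mul (hv.continuous.norm.pow 2))

lemma IsBoundedSmoothDomain.carlemanEstimate_H1 (hΩ : IsBoundedSmoothDomain Ω) (hX : X ≠ 0)
    (hψ : ContDiff ℝ ∞ ψ) (hc : LocallyStrictlyConvex Ω ψ) :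
    CarlemanEstimate Ω X ψ (normH1 Ω) := by
  obtain ⟨c, hcpos, hH⟩ := hc.exists_lower_bound hΩ.isCompact_closure hψ
  have hXn : 0 < ‖X‖ := norm_pos_iff.2 hX
  -- Cauchy–Schwarz, `⟨X, ξ⟩² ≤ ‖X‖² |ξ|²`, weakens the full Hessian bound to the one in direction
  -- `X`; the full bound is used again for the gradient.
  refine hΩ.carlemanEstimate_of_le hX hψ (c := c / ‖X‖ ^ 2) (by positivity) (fun x hx ξ => ?_)
    fun c₁ hc₁ => ⟨min (4 * c) c₁, by positivity, fun h hh v hv => ?_⟩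
  · refine le_trans ?_ (hH x hx ξ)
    rw [div_mul_eq_mul_div, div_le_iff₀ (by positivity), mul_assoc]
    gcongr
    rw [mul_comm]
    exact sum_mul_sq_le X ξ
  · have hre := fun j => (contDiff_pd (contDiff_re hv) j).continuous
    have him := fun j => (contDiff_pd (contDiff_im hv) j).continuous
    rw [hΩ.normH1_sq hv, ← integral_const_mul]
    refine setIntegral_mono_on (hΩ.integrableOn ?_) (hΩ.integrableOn (continuous_density hψ hv _ _))
      hΩ.isOpen.measurableSet fun x hx => ?_
    · exact continuous_const.mul ((hv.continuous.norm.pow 2).add (continuous_const.mul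
        ((continuous_finsetSum _ fun j _ => (hre j).pow 2).add
          (continuous_finsetSum _ fun j _ => (him j).pow 2))))
    · have h1 := hH x hx fun j => pd j (fun y => (v y).re) x
      have h2 := hH x hx fun j => pd j (fun y => (v y).im) x
      set a := ∑ j, pd j (fun y => (v y).re) x ^ 2 with ha
      set b := ∑ j, pd j (fun y => (v y).im) x ^ 2 with hb
      have ha0 : 0 ≤ a := Finset.sum_nonneg fun _ _ => sq_nonneg _
      have hb0 : 0 ≤ b := Finset.sum_nonneg fun _ _ => sq_nonneg _
      calc min (4 * c) c₁ * (‖v x‖ ^ 2 + h ^ 2 * (a + b))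
          = min (4 * c) c₁ * (h ^ 2 * (a + b)) + min (4 * c) c₁ * ‖v x‖ ^ 2 := by ring
        _ ≤ 4 * c * (h ^ 2 * (a + b)) + c₁ * ‖v x‖ ^ 2 := by
          gcongr
          · exact min_le_left _ _
          · exact min_le_right _ _
        _ = 4 * h ^ 2 * (c * a + c * b) + c₁ * ‖v x‖ ^ 2 := by ring
        _ ≤ _ := by gcongr

lemma IsBoundedSmoothDomain.carlemanEstimate_HX (hΩ : IsBoundedSmoothDomain Ω) (hX : X ≠ 0)
    (hψ : ContDiff ℝ ∞ ψ) (hc : IsConvexInDirection Ω X ψ) :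
    CarlemanEstimate Ω X ψ (normHX Ω X) := by
  obtain ⟨c, hcpos, hH⟩ := hc.exists_lower_bound hΩ.isOpen hΩ.isCompact_closure
  refine hΩ.carlemanEstimate_of_le hX hψ hcpos hH
    -- The factor 1/2 pays for `(a + b)² ≤ 2(a² + b²)`, since `normHX` is a sum of norms rather than
    -- a root of a sum of squares.
    fun c₁ hc₁ => ⟨min (4 * c) c₁ / 2, by positivity, fun h hh v hv => ?_⟩
  have hre := fun j => (contDiff_pd (contDiff_re hv) j).continuous
  have him := fun j => (contDiff_pd (contDiff_im hv) j).continuous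
  refine (mul_le_mul_of_nonneg_left (hΩ.normHX_sq_le hv) (by positivity)).trans ?_
  rw [← mul_assoc, div_mul_cancel₀ _ two_ne_zero, ← integral_const_mul]
  refine setIntegral_mono_on (hΩ.integrableOn ?_) (hΩ.integrableOn (continuous_density hψ hv _ _))
    hΩ.isOpen.measurableSet fun x hx => ?_
  · exact continuous_const.mul ((hv.continuous.norm.pow 2).add (continuous_const.mul
      (((continuous_finsetSum _ fun j _ => continuous_const.mul (hre j)).pow 2).add
        ((continuous_finsetSum _ fun j _ => continuous_const.mul (him j)).pow 2))))
  · have h1 := hH x hx fun j => pd j (fun y => (v y).re) x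
    have h2 := hH x hx fun j => pd j (fun y => (v y).im) x
    set a := (∑ j, X j * pd j (fun y => (v y).re) x) ^ 2 with ha
    set b := (∑ j, X j * pd j (fun y => (v y).im) x) ^ 2 with hb
    have ha0 : 0 ≤ a := sq_nonneg _
    have hb0 : 0 ≤ b := sq_nonneg _
    calc min (4 * c) c₁ * (‖v x‖ ^ 2 + h ^ 2 * (a + b))
        = min (4 * c) c₁ * (h ^ 2 * (a + b)) + min (4 * c) c₁ * ‖v x‖ ^ 2 := by ring
      _ ≤ 4 * c * (h ^ 2 * (a + b)) + c₁ * ‖v x‖ ^ 2 := by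
        gcongr
        · exact min_le_left _ _
        · exact min_le_right _ _
      _ = 4 * h ^ 2 * (c * a + c * b) + c₁ * ‖v x‖ ^ 2 := by ring
      _ ≤ _ := by gcongr

end Convexity

end SemiclassicalCarleman

end

theorem mainTheorem7 {d : ℕ} (Ω : Set (SemiclassicalCarleman.Euc d))
    (hΩ : SemiclassicalCarleman.IsBoundedSmoothDomain Ω)
    (X : SemiclassicalCarleman.Euc d) (hX : X ≠ 0)
    (ψ : SemiclassicalCarleman.Euc d → ℝ) (hψ : ContDiff ℝ ∞ ψ) :
    (SemiclassicalCarleman.LocallyStrictlyConvex Ω ψ →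
      SemiclassicalCarleman.CarlemanEstimate Ω X ψ (SemiclassicalCarleman.normH1 Ω)) ∧
    (SemiclassicalCarleman.IsConvexInDirection Ω X ψ →
      SemiclassicalCarleman.CarlemanEstimate Ω X ψ (SemiclassicalCarleman.normHX Ω X)) :=
  ⟨hΩ.carlemanEstimate_H1 hX hψ, hΩ.carlemanEstimate_HX hX hψ⟩
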